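/- For $z\ge 0$ and $0<\delta\le\sqrt2$ put $$R(z,\delta)=z+\frac{\log(2/\delta^2)}{\log\!\left(e+\frac{\log(2/\delta^2)}{z}\right)}\quad(z>0),\qquad R(0,\delta)=0.$$ There are universal constants $c,C>0$ such that for all $\Lambda>0$, $t\in\mathbb R$ and $0<\delta\le\sqrt2$ there are $N\in\mathbb N$, $\omega\in\mathbb R$ and $\theta,\phi\in\mathbb R^{2N+1}$, depending only on $\Lambda,t,\delta$, with the following properties. Write $R_z(\alpha)=e^{-i\alpha Z/2}$, $R_y(\alpha)=e^{-i\alpha Y/2}$. For a unitary $V$ let $$\mathrm{QPP}(V)=R_z(\omega)R_y(\theta_0)R_z(\phi_0)\prod_{l=1}^{N}\begin{bmatrix}V^\dagger&0\\0&I\end{bmatrix}R_y(\theta_{2l-1})R_z(\phi_{2l-1})\begin{bmatrix}I&0\\0&V\end{bmatrix}R_y(\theta_{2l})R_z(\phi_{2l})$$ (rotations on one extra first qubit), and let $P(x)$ be the upper-left entry of the $2\times2$ matrix $R_z(\omega)R_y(\theta_0)R_z(\phi_0)\prod_{l=1}^{2N}R_z(x)R_y(\theta_l)R_z(\phi_l)$.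 For a unitary $U$ on $m+n$ qubits let $\widehat U=\mathrm{REFLECTOR}\cdot \mathsf H\,\mathsf X\,(\text{controlled-}U^\dagger)(\text{open-controlled-}U)\,\mathsf H$ be its qubitization, where $\mathsf H,\mathsf X$ and the controls are on one further ancilla qubit and $\mathrm{REFLECTOR}=(2|0^{m+1}\rangle\langle0^{m+1}|-I)\otimes I$. 1. For every $n$-qubit Hermitian $H$ with $\|H\|\le\Lambda$ and every unitary $U_H$ on $m+n$ qubits with $(\langle0^m|\otimes I)\,U_H\,(|0^m\rangle\otimes I)=H/\Lambda$ ($n,m\ge 0$ arbitrary), the unitary $W=\mathrm{QPP}(\widehat U_H)$ simulates $e^{-iHt}$ to precision $\delta$: $$\big\|W(|0^{m+2}\rangle\otimes I)-|0^{m+2}\rangle\otimes e^{-iHt}\big\|\le\delta .$$ 2. $W$ is implemented, on the two ancilla qubits together with the $m+n$ qubits of $U_H$, by a circuit (independent of $H$ and $U_H$ except through its queries) of one-qubit rotations and Hadamard gates on the ancillas, controlled-$\mathsf X$ and controlled-$\mathrm{REFLECTOR}$ gates, and $Q$ queries in total to controlled-$U_H$ and controlled-$U_H^\dagger$, where $Q=\Theta(R(\Lambda|t|,\delta))$: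 always $Q\le C\,R(\Lambda|t|,\delta)$, and $Q\ge c\,R(\Lambda|t|,\delta)$ whenever $R(\Lambda|t|,\delta)\ge1$. 3. $P$ is, up to a factor $s\in(0,1]$, the truncated Jacobi–Anger series: $P(x)=s\sum_{k=-N}^{N}i^kJ_k(-\Lambda t)e^{ikx}$ for all $x\in\mathbb R$, where $J_k$ is the Bessel function of the first kind, and $|P(x)-e^{-i\Lambda t\cos x}|\le\delta^2/2$ for all $x\in\mathbb R$. -/

import Mathlib

open scoped Kronecker Matrix Matrix.Norms.L2Operator

namespace QPP

noncomputable section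

/-- Computational basis of a register of `k` qubits; `0` is the label of `|0…0⟩`. -/
abbrev Qubits (k : ℕ) : Type := Fin k → Fin 2

/-- Basis of the block-encoding register (`m` qubits) together with the system (`n` qubits). -/
abbrev BlockReg (m n : ℕ) : Type := Qubits m × Qubits n

/-- Basis of the whole machine: the QPP ancilla qubit, the qubitization ancilla qubit, the `m`
qubits that the block encoding itself acts on, and the `n` system qubits. -/
abbrev Reg (m n : ℕ) : Type := Fin 2 × Fin 2 × BlockReg m n

/-- `U` is a block encoding of `A` with `m` ancilla qubits: `U` is unitary and
`(⟨0^m| ⊗ I) U (|0^m⟩ ⊗ I) = A`. -/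
def IsBlockEncoding {m n : ℕ} (U : Matrix (BlockReg m n) (BlockReg m n) ℂ)
    (A : Matrix (Qubits n) (Qubits n) ℂ) : Prop :=
  U ∈ Matrix.unitaryGroup (BlockReg m n) ℂ ∧ ∀ i j, U (0, i) (0, j) = A i j

/-! ### Single-qubit gates and controlled operations -/

/-- `R_z(φ) = e^{-iφZ/2}`. -/
def rotZ (φ : ℝ) : Matrix (Fin 2) (Fin 2) ℂ :=
  !![Complex.exp (-(Complex.I * φ / 2)), 0; 0, Complex.exp (Complex.I * φ / 2)]

/-- `R_y(θ) = e^{-iθY/2}`. -/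
def rotY (θ : ℝ) : Matrix (Fin 2) (Fin 2) ℂ :=
  !![(Real.cos (θ / 2) : ℂ), -(Real.sin (θ / 2) : ℂ);
     (Real.sin (θ / 2) : ℂ), (Real.cos (θ / 2) : ℂ)]

/-- The Pauli gate `X`. -/
def pauliX : Matrix (Fin 2) (Fin 2) ℂ := !![0, 1; 1, 0]

/-- The Hadamard gate. -/
def hadamard : Matrix (Fin 2) (Fin 2) ℂ := ((1 / Real.sqrt 2 : ℝ) : ℂ) • !![1, 1; 1, -1]

/-- `V` controlled by an additional first qubit: `V` is applied when that qubit is `|b⟩`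
(`b = 1`: the usual control, `b = 0`: the open control). -/
def ctrl {ι : Type*} [DecidableEq ι] (b : Fin 2) (V : Matrix ι ι ℂ) :
    Matrix (Fin 2 × ι) (Fin 2 × ι) ℂ :=
  Matrix.single b b (1 : ℂ) ⊗ₖ V + (1 - Matrix.single b b (1 : ℂ)) ⊗ₖ (1 : Matrix ι ι ℂ)

/-! ### Trigonometric quantum signal processing and quantum phase processing -/

/-- `R_z(ω) R_y(θ₀) R_z(φ₀) ∏_{l=1}^{L} R_z(x) R_y(θ_l) R_z(φ_l)`. -/
def qsp (L : ℕ) (ω : ℝ) (θ φ : Fin (L + 1) → ℝ) (x : ℝ) : Matrix (Fin 2) (Fin 2) ℂ :=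
  rotZ ω * rotY (θ 0) * rotZ (φ 0) *
    (List.ofFn fun l : Fin L => rotZ x * rotY (θ l.succ) * rotZ (φ l.succ)).prod

/-- Quantum phase processing of `V` with `L` layers: `R_z(ω) R_y(θ₀) R_z(φ₀)` on the first qubit,
followed (in the order of the matrix product) by the layers `l = 1, …, L`, where layer `l` is
`diag(V†, I)` for odd `l` and `diag(I, V)` for even `l`, times `R_y(θ_l) R_z(φ_l)` on the
first qubit. The index `l : Fin L` below stands for layer `l + 1`. -/
def qpp {ι : Type*} [Fintype ι] [DecidableEq ι] (L : ℕ) (ω : ℝ) (θ φ : Fin (L + 1) → ℝ)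
    (V : Matrix ι ι ℂ) : Matrix (Fin 2 × ι) (Fin 2 × ι) ℂ :=
  (rotZ ω * rotY (θ 0) * rotZ (φ 0)) ⊗ₖ (1 : Matrix ι ι ℂ) *
    (List.ofFn fun l : Fin L =>
      (if Even (l : ℕ) then ctrl 0 Vᴴ else ctrl 1 V) *
        ((rotY (θ l.succ) * rotZ (φ l.succ)) ⊗ₖ (1 : Matrix ι ι ℂ))).prod

/-! ### Qubitization -/

/-- The reflection `(2 |0^{m+1}⟩⟨0^{m+1}| - I) ⊗ I` about the all-zero state of the qubitization
ancilla and the block-encoding register. -/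
def reflector (m n : ℕ) : Matrix (Fin 2 × BlockReg m n) (Fin 2 × BlockReg m n) ℂ :=
  Matrix.diagonal fun p => if p.1 = 0 ∧ p.2.1 = 0 then 1 else -1

/-- The qubitized block encoding
`Û = REFLECTOR · (H ⊗ I) (X ⊗ I) (controlled-U†) (open-controlled-U) (H ⊗ I)`. -/
def qubitize {m n : ℕ} (U : Matrix (BlockReg m n) (BlockReg m n) ℂ) :
    Matrix (Fin 2 × BlockReg m n) (Fin 2 × BlockReg m n) ℂ :=
  reflector m n *
    ((hadamard ⊗ₖ (1 : Matrix (BlockReg m n) (BlockReg m n) ℂ)) *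
      (pauliX ⊗ₖ (1 : Matrix (BlockReg m n) (BlockReg m n) ℂ)) *
      ctrl 1 Uᴴ * ctrl 0 U *
      (hadamard ⊗ₖ (1 : Matrix (BlockReg m n) (BlockReg m n) ℂ)))

/-! ### Circuits with oracle access to controlled-`U` and controlled-`U†` -/

/-- Elementary gates. Only `queryU` and `queryUdag` depend on the block encoding `U`. -/
inductive Gate : Type
  /-- `R_z(φ)` on the QPP ancilla -/
  | rz (φ : ℝ)
  /-- `R_y(θ)` on the QPP ancilla -/
  | ry (θ : ℝ)
  /-- Hadamard gate on the qubitization ancilla -/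
  | had
  /-- `X` on the qubitization ancilla, controlled by the QPP ancilla being `|b⟩` -/
  | cX (b : Fin 2)
  /-- reflection about `|0^{m+1}⟩`, controlled by the QPP ancilla being `|b⟩` -/
  | cReflect (b : Fin 2)
  /-- one query to controlled-`U`, the control being the qubitization ancilla -/
  | queryU
  /-- one query to controlled-`U†`, the control being the qubitization ancilla -/
  | queryUdag

/-- The unitary that a gate applies to the whole machine. -/
def Gate.eval {m n : ℕ} (U : Matrix (BlockReg m n) (BlockReg m n) ℂ) :
    Gate → Matrix (Reg m n) (Reg m n) ℂ
  | .rz φ => rotZ φ ⊗ₖ (1 : Matrix (Fin 2 × BlockReg m n) (Fin 2 × BlockReg m n) ℂ)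
  | .ry θ => rotY θ ⊗ₖ (1 : Matrix (Fin 2 × BlockReg m n) (Fin 2 × BlockReg m n) ℂ)
  | .had => (1 : Matrix (Fin 2) (Fin 2) ℂ) ⊗ₖ
      (hadamard ⊗ₖ (1 : Matrix (BlockReg m n) (BlockReg m n) ℂ))
  | .cX b => ctrl b (pauliX ⊗ₖ (1 : Matrix (BlockReg m n) (BlockReg m n) ℂ))
  | .cReflect b => ctrl b (reflector m n)
  | .queryU => (1 : Matrix (Fin 2) (Fin 2) ℂ) ⊗ₖ ctrl 1 U
  | .queryUdag => (1 : Matrix (Fin 2) (Fin 2) ℂ) ⊗ₖ ctrl 1 Uᴴ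

/-- The number of queries that a gate makes. -/
def Gate.cost : Gate → ℕ
  | .queryU => 1
  | .queryUdag => 1
  | _ => 0

/-- A circuit, listed in the order of the matrix product (the last gate is applied first). -/
abbrev Circuit : Type := List Gate

/-- The unitary that a circuit implements. -/
def Circuit.eval {m n : ℕ} (K : Circuit) (U : Matrix (BlockReg m n) (BlockReg m n) ℂ) :
    Matrix (Reg m n) (Reg m n) ℂ :=
  (List.map (Gate.eval U) K).prod

/-- The total number of queries to controlled-`U` and controlled-`U†` made by a circuit. -/
def Circuit.queryCount (K : Circuit) : ℕ := (List.map Gate.cost K).sum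

/-- Circuit for `Û`, controlled by the QPP ancilla being `|1⟩`. -/
def ctrlQubitized : Circuit :=
  [.cReflect 1, .had, .cX 1, .queryUdag, .cX 1, .queryU, .cX 1, .had]

/-- Circuit for `Û†`, controlled by the QPP ancilla being `|0⟩`. -/
def openCtrlQubitizedAdj : Circuit :=
  [.had, .cX 0, .queryUdag, .cX 0, .queryU, .cX 0, .had, .cReflect 0]

/-- The circuit of quantum phase processing with `L` layers on the qubitized block encoding. -/
def simCircuit (L : ℕ) (ω : ℝ) (θ φ : Fin (L + 1) → ℝ) : Circuit :=
  [.rz ω, .ry (θ 0), .rz (φ 0)] ++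
    (List.ofFn fun l : Fin L =>
      (if Even (l : ℕ) then openCtrlQubitizedAdj else ctrlQubitized) ++
        [Gate.ry (θ l.succ), Gate.rz (φ l.succ)]).flatten

/-- The isometry `|0^{m+2}⟩ ⊗ I` from the system into the whole machine. -/
def initAncilla (m n : ℕ) : Matrix (Reg m n) (Qubits n) ℂ :=
  Matrix.of fun p j => if p.1 = 0 ∧ p.2.1 = 0 ∧ p.2.2.1 = 0 ∧ p.2.2.2 = j then 1 else 0

/-- `W` simulates the evolution `e^{-iHt}` within precision `δ`: for every normalized `ψ`,
`W |0^{m+2}, ψ⟩` is within `δ` of `|0^{m+2}⟩ e^{-iHt} |ψ⟩`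
(the norm is the spectral norm of a matrix). -/
def Simulates {m n : ℕ} (W : Matrix (Reg m n) (Reg m n) ℂ)
    (H : Matrix (Qubits n) (Qubits n) ℂ) (t δ : ℝ) : Prop :=
  ‖W * initAncilla m n - initAncilla m n * NormedSpace.exp ((-(Complex.I * t)) • H)‖ ≤ δ

/-! ### The Jacobi–Anger series and the query complexity -/

/-- The Bessel function of the first kind `J_k(z)` of integer order, by its power series for
`k ≥ 0` and by `J_{-k} = (-1)^k J_k`. -/
def besselJ (k : ℤ) (z : ℝ) : ℝ :=
  (if k < 0 then (-1) ^ k.natAbs else 1) *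
    ∑' j : ℕ, (-1) ^ j / ((j.factorial : ℝ) * ((j + k.natAbs).factorial : ℝ)) *
      (z / 2) ^ (2 * j + k.natAbs)

/-- The truncation `∑_{k=-N}^{N} i^k J_k(z) e^{ikx}` of the Jacobi–Anger series of
`e^{iz cos x}`. -/
def jacobiAnger (N : ℕ) (z x : ℝ) : ℂ :=
  ∑ k ∈ Finset.Icc (-(N : ℤ)) (N : ℤ),
    Complex.I ^ k * (besselJ k z : ℂ) * Complex.exp (Complex.I * k * x)

/-- `z + log(2/δ²) / log(e + log(2/δ²)/z)`, continued by its limit `0` to `z = 0`. -/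
def simRate (z δ : ℝ) : ℝ :=
  if z = 0 then 0
  else z + Real.log (2 / δ ^ 2) / Real.log (Real.exp 1 + Real.log (2 / δ ^ 2) / z)

end

end QPP

open QPP

/-! Everything reduces to a scalar statement on the unit circle. Write `V` for the qubitized
encoding. The reflection fixes the initial subspace and negates its complement, so `V + Vᴴ` maps
that subspace into itself and acts there as `2H/Λ` (`qubitize_add_conjTranspose_mul_initBlock`).
Hence `exp(-iΛt(V + Vᴴ)/2)` restricts to `exp(-iHt)`, and no analysis of two-dimensional invariant
subspaces is needed.

Since `V` is unitary, the functional calculus transports the whole processing circuit from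
continuous functions on the spectrum, where a point `e^{ix}` gives the 2×2 product `qsp`. If the
corner entry `P` is within `δ²/2` of `e^{-iΛt cos x}`, unitarity of the column bounds the full
column error by `δ` (`column_error_le`, `qpp_initQubit_sub_norm_le`).

It remains to produce such a `P`. The truncated Jacobi–Anger series has an explicit tail bound
(`jacobiAnger_tail_bound`), small enough once `N + 1 ≥ 2e³R` (`tail_le_of_simRate_le`). Scaled to
have modulus below 1, it has a complementary polynomial by Fejér–Riesz (`exists_complement`), and a
complementary pair is realized by angles found one layer at a time (`exists_qsp_angles`). Each of
the `2N` layers costs two queries. -/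

/-! ### The Jacobi–Anger series and its truncation error -/

/-- Pairs of naturals, indexed by their difference and their minimum. -/
def diffMinEquiv : ℤ × ℕ ≃ ℕ × ℕ where
  toFun p := (p.2 + p.1.toNat, p.2 + (-p.1).toNat)
  invFun p := ((p.1 : ℤ) - p.2, min p.1 p.2)
  left_inv p := by
    obtain ⟨k, j⟩ := p
    ext <;> simp only <;> omega
  right_inv p := by
    obtain ⟨a, b⟩ := p
    ext <;> simp only <;> omega

/-- Terms of the product of the exponential series of `u` and `v`. -/
noncomputable def expTerm (u v : ℂ) (p : ℕ × ℕ) : ℂ :=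
  (u ^ p.1 / p.1.factorial) * (v ^ p.2 / p.2.factorial)

theorem hasSum_expTerm (u v : ℂ) : HasSum (expTerm u v) (Complex.exp (u + v)) := by
  have hs : ∀ y : ℂ, HasSum (fun n : ℕ => y ^ n / n.factorial) (Complex.exp y) := fun y => by
    rw [Complex.exp_eq_exp_ℂ]
    exact NormedSpace.expSeries_div_hasSum_exp y
  have hn : ∀ y : ℂ, Summable fun n : ℕ => ‖y ^ n / n.factorial‖ := fun y =>
    NormedSpace.norm_expSeries_div_summable y
  rw [Complex.exp_add]
  have := (summable_mul_of_summable_norm (hn u) (hn v)).hasSum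
  rw [← tsum_mul_tsum_of_summable_norm (hn u) (hn v), (hs u).tsum_eq, (hs v).tsum_eq] at this
  exact this

/-- Since `u * v = -(z/2)²` is free of `x`, the terms of `exp u * exp v` with exponent difference
`k` share the factor `e^{ikx}`; what remains is the Bessel power series. -/
theorem jacobiAnger_fiber (z x : ℝ) (k : ℤ) :
    HasSum (fun j : ℕ => expTerm (Complex.I * z / 2 * Complex.exp (Complex.I * x))
        (Complex.I * z / 2 * Complex.exp (-(Complex.I * x))) (diffMinEquiv (k, j)))
      (Complex.I ^ k * (besselJ k z : ℂ) * Complex.exp (Complex.I * k * x)) := by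
  set u := Complex.I * z / 2 * Complex.exp (Complex.I * x) with hu
  set v := Complex.I * z / 2 * Complex.exp (-(Complex.I * x)) with hv
  have hsum : Summable fun j : ℕ => expTerm u v (diffMinEquiv (k, j)) :=
    ((diffMinEquiv.summable_iff.mpr (hasSum_expTerm u v).summable)).comp_injective
      (Prod.mk_right_injective k)
  have huv : u * v = -((z / 2 : ℝ) : ℂ) ^ 2 := by
    rw [hu, hv]
    have h1 : Complex.exp (Complex.I * x) * Complex.exp (-(Complex.I * x)) = 1 := by
      rw [← Complex.exp_add, add_neg_cancel, Complex.exp_zero]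
    have h2 := Complex.I_sq
    push_cast
    linear_combination (Complex.I ^ 2 * (z : ℂ) ^ 2 / 4) * h1 + ((z : ℂ) ^ 2 / 4) * h2
  have key : ∀ j : ℕ, expTerm u v (diffMinEquiv (k, j)) =
      Complex.I ^ k * Complex.exp (Complex.I * k * x) *
      (((if k < 0 then (-1) ^ k.natAbs else 1) *
      ((-1) ^ j / ((j.factorial : ℝ) * ((j + k.natAbs).factorial : ℝ)) *
      (z / 2) ^ (2 * j + k.natAbs)) : ℝ) : ℂ) := by
    intro j
    rcases lt_or_ge k 0 with hk | hk
    · obtain ⟨m, rfl⟩ : ∃ m : ℕ, k = -(m : ℤ) := ⟨k.natAbs, by omega⟩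
      -- The sign `(-1)^m` in `J_{-m}` turns `I^{-m}` into `I^m`, as the surplus power `v^m`
      -- requires.
      have e : Complex.I ^ (-(m : ℤ)) * Complex.exp (Complex.I * ((-(m : ℤ) : ℤ) : ℂ) * x)
          * (-1) ^ m = (Complex.I * Complex.exp (-(Complex.I * x))) ^ m := by
        rw [zpow_neg, zpow_natCast, ← inv_pow, Complex.inv_I, mul_pow, ← Complex.exp_nat_mul,
          mul_right_comm, ← mul_pow]
        congr 1
        · congr 1; ring
        · congr 1; push_cast; ring
      have e2 : v ^ m = (Complex.I * Complex.exp (-(Complex.I * x))) ^ m * ((z / 2 : ℝ) : ℂ) ^ m := by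
        rw [← mul_pow, hv]; congr 1; push_cast; ring
      simp only [expTerm, diffMinEquiv, Equiv.coe_fn_mk, hk, if_true, neg_neg, Int.toNat_natCast,
        Int.natAbs_neg, Int.natAbs_natCast]
      have e3 : (-(m : ℤ)).toNat = 0 := by omega
      rw [e3, add_zero, pow_add v, e2]
      have e4 : u ^ j * v ^ j = (-1) ^ j * ((z / 2 : ℝ) : ℂ) ^ (2 * j) := by
        rw [← mul_pow, huv, neg_pow, pow_mul]
      rw [← e]
      generalize Complex.I ^ (-(m : ℤ)) * Complex.exp (Complex.I * ((-(m : ℤ) : ℤ) : ℂ) * x) = q at *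
      clear_value u v
      push_cast
      push_cast at e4
      rw [pow_add _ (2 * j)]
      linear_combination q * (-1) ^ m * ((z : ℂ) / 2) ^ m / (j.factorial * (j + m).factorial) * e4
    · obtain ⟨m, rfl⟩ : ∃ m : ℕ, k = (m : ℤ) := ⟨k.natAbs, by omega⟩
      have e : Complex.I ^ (m : ℤ) * Complex.exp (Complex.I * ((m : ℤ) : ℂ) * x)
          = (Complex.I * Complex.exp (Complex.I * x)) ^ m := by
        rw [zpow_natCast, mul_pow, ← Complex.exp_nat_mul]
        congr 2; push_cast; ring
      have e2 : u ^ m = (Complex.I * Complex.exp (Complex.I * x)) ^ m * ((z / 2 : ℝ) : ℂ) ^ m := by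
        rw [← mul_pow, hu]; congr 1; push_cast; ring
      simp only [expTerm, diffMinEquiv, Equiv.coe_fn_mk, not_lt.mpr hk, if_false, Int.toNat_natCast,
        Int.natAbs_natCast]
      have e3 : (-(m : ℤ)).toNat = 0 := by omega
      rw [e3, add_zero, pow_add u, e2]
      have e4 : u ^ j * v ^ j = (-1) ^ j * ((z / 2 : ℝ) : ℂ) ^ (2 * j) := by
        rw [← mul_pow, huv, neg_pow, pow_mul]
      rw [← e]
      generalize Complex.I ^ (m : ℤ) * Complex.exp (Complex.I * ((m : ℤ) : ℂ) * x) = q at *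
      clear_value u v
      push_cast
      push_cast at e4
      rw [one_mul, pow_add _ (2 * j)]
      linear_combination q * ((z : ℂ) / 2) ^ m / (j.factorial * (j + m).factorial) * e4
  have hval : Complex.I ^ k * (besselJ k z : ℂ) * Complex.exp (Complex.I * k * x) =
      ∑' j : ℕ, expTerm u v (diffMinEquiv (k, j)) := by
    simp_rw [key]
    rw [tsum_mul_left, besselJ, ← tsum_mul_left, Complex.ofReal_tsum]
    ring
  rw [hval]
  exact hsum.hasSum

/-- An omitted pair of exponents differs by more than `N`, so its total degree is at least `N + 1`.
Comparing with the same double series at a larger argument `M` gains `(|z|/M)^(N+1)` and costs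
`e^M`. -/
theorem jacobiAnger_tail_bound (N : ℕ) (z x : ℝ) (hz : |z| ≤ N + 1) :
    ‖jacobiAnger N z x - Complex.exp (Complex.I * z * Real.cos x)‖ ≤
      (Real.exp 1 * |z| / (N + 1)) ^ (N + 1) := by
  set u := Complex.I * z / 2 * Complex.exp (Complex.I * x) with hu
  set v := Complex.I * z / 2 * Complex.exp (-(Complex.I * x)) with hv
  have huv : Complex.I * z * Real.cos x = u + v := by
    rw [hu, hv, Complex.ofReal_cos, Complex.cos, mul_comm (x : ℂ)]
    ring_nf
  have hF := hasSum_expTerm u v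
  have hFe := (diffMinEquiv.hasSum_iff).mpr hF
  set S := Finset.Icc (-(N : ℤ)) (N : ℤ) with hS
  -- the partial sum as a sum over a band of pairs
  have hband : HasSum (fun q : ℤ × ℕ => if q.1 ∈ S then expTerm u v (diffMinEquiv q) else 0)
      (jacobiAnger N z x) := by
    have hsm : Summable (fun q : ℤ × ℕ => if q.1 ∈ S then expTerm u v (diffMinEquiv q) else 0) := by
      have := hFe.summable.indicator {q : ℤ × ℕ | q.1 ∈ S}
      refine this.congr fun q => ?_
      by_cases hq : q.1 ∈ S <;> simp [hq]
    have h1 := hsm.hasSum.prod_fiberwise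
      (g := fun k => if k ∈ S then
        Complex.I ^ k * (besselJ k z : ℂ) * Complex.exp (Complex.I * k * x) else 0) (by
        intro k
        by_cases hk : k ∈ S
        · simpa [hk] using jacobiAnger_fiber z x k
        · simp [hk])
    have h2 : HasSum (fun k => if k ∈ S then
        Complex.I ^ k * (besselJ k z : ℂ) * Complex.exp (Complex.I * k * x) else 0)
        (jacobiAnger N z x) := by
      have := hasSum_sum_of_ne_finset_zero (L := .unconditional ℤ) (s := S) (f := fun k : ℤ => if k ∈ S then
        Complex.I ^ k * (besselJ k z : ℂ) * Complex.exp (Complex.I * k * x) else 0)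
        (fun k hk => by simp [hk])
      convert this using 1
      rw [jacobiAnger, ← hS]
      exact Finset.sum_congr rfl fun k hk => by simp [hk]
    rw [← h1.unique h2]
    exact hsm.hasSum
  have hdiff := hband.sub hFe
  rw [huv]
  -- `M = N + 1` minimizes `e^M (|z|/M)^(N+1)`.
  set M : ℝ := (N : ℝ) + 1 with hM
  have hM0 : 0 < M := by positivity
  set r : ℝ := |z| / M with hr
  have hr0 : 0 ≤ r := by positivity
  have hr1 : r ≤ 1 := (div_le_one hM0).mpr hz
  -- the majorant
  have hmaj0 : HasSum (fun p : ℕ × ℕ => ((M / 2) ^ p.1 / p.1.factorial) *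
      ((M / 2) ^ p.2 / p.2.factorial)) (Real.exp M) := by
    have := hasSum_expTerm ((M / 2 : ℝ) : ℂ) ((M / 2 : ℝ) : ℂ)
    rw [← Complex.ofReal_add, add_halves, ← Complex.ofReal_exp] at this
    rw [← Complex.hasSum_ofReal]
    convert this using 1
    ext p
    simp [expTerm]
  have hmaj := (diffMinEquiv.hasSum_iff.mpr (hmaj0.mul_left (r ^ (N + 1))))
  have hb := hdiff.norm_le_of_bounded hmaj (by
    intro q
    by_cases hq : q.1 ∈ S
    · simp only [hq, if_true, Function.comp, sub_self, norm_zero]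
      positivity
    · simp only [hq, if_false, Function.comp, zero_sub, norm_neg]
      have hge : N + 1 ≤ (diffMinEquiv q).1 + (diffMinEquiv q).2 := by
        rw [hS, Finset.mem_Icc] at hq
        simp only [diffMinEquiv, Equiv.coe_fn_mk]
        omega
      generalize diffMinEquiv q = p at *
      have hnu : ‖u‖ = r * (M / 2) := by
        have : ‖Complex.exp (Complex.I * x)‖ = 1 := by
          rw [mul_comm]; exact Complex.norm_exp_ofReal_mul_I x
        rw [hu, norm_mul, this, hr]
        simp
        field_simp
      have hnv : ‖v‖ = r * (M / 2) := by
        have : ‖Complex.exp (-(Complex.I * x))‖ = 1 := by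
          have := Complex.norm_exp_ofReal_mul_I (-x)
          rw [← this]; congr 2; push_cast; ring
        rw [hv, norm_mul, this, hr]
        simp
        field_simp
      rw [expTerm, norm_mul, norm_div, norm_div, norm_pow, norm_pow, hnu, hnv]
      simp only [Complex.norm_natCast]
      have : r ^ (p.1 + p.2) ≤ r ^ (N + 1) := pow_le_pow_of_le_one hr0 hr1 hge
      calc (r * (M / 2)) ^ p.1 / p.1.factorial * ((r * (M / 2)) ^ p.2 / p.2.factorial)
          = r ^ (p.1 + p.2) * ((M / 2) ^ p.1 / p.1.factorial * ((M / 2) ^ p.2 / p.2.factorial)) := by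
            rw [mul_pow, mul_pow, pow_add]; ring
        _ ≤ _ := by gcongr)
  refine hb.trans (le_of_eq ?_)
  have : Real.exp M = Real.exp 1 ^ (N + 1) := by
    rw [← Real.exp_nat_mul]; congr 1; push_cast; ring
  rw [this, ← mul_pow, hr]
  congr 1
  ring

/-! ### The truncation order as a function of the precision -/

/-- With `g = log(e + u)` and `s = e^{g/2}`, one has `s² = e + u ≤ 2s + 2u` and `g ≤ s`. Applied to
`u = log(2/δ²)/z` and multiplied by `z`, it bounds `z e^{g/2}` by twice the rate, which makes the
base of the tail exponentially small in `g`. -/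
theorem half_exp_half_log_le {u : ℝ} (hu : 0 ≤ u) :
    1 ≤ Real.log (Real.exp 1 + u) ∧
    Real.exp (Real.log (Real.exp 1 + u) / 2) / 2 ≤ 1 + u / Real.log (Real.exp 1 + u) := by
  have he : 0 < Real.exp 1 + u := by positivity
  have hg : 1 ≤ Real.log (Real.exp 1 + u) := by
    rw [Real.le_log_iff_exp_le he]; linarith
  refine ⟨hg, ?_⟩
  have hs2 : Real.exp (Real.log (Real.exp 1 + u) / 2) ^ 2 = Real.exp 1 + u := by
    rw [← Real.exp_nat_mul]
    push_cast
    rw [mul_div_cancel₀ _ (two_ne_zero), Real.exp_log he]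
  generalize Real.log (Real.exp 1 + u) = g at *
  have h1 : g ≤ Real.exp (g / 2) := by
    have := Real.quadratic_le_exp_of_nonneg (x := g / 2) (by linarith)
    nlinarith [sq_nonneg (g - 2)]
  have hse : Real.exp (1 / 2) ≤ Real.exp (g / 2) := Real.exp_le_exp.mpr (by linarith)
  have he4 : Real.exp 1 = Real.exp (1 / 2) ^ 2 := by
    rw [← Real.exp_nat_mul]; norm_num
  have hlt : Real.exp (1 / 2) ≤ 2 := by
    have := Real.exp_one_lt_d9
    have := Real.exp_pos (1 / 2 : ℝ)
    nlinarith
  generalize Real.exp (g / 2) = s at *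
  have hs0 : 0 < s := by linarith
  calc s / 2 ≤ 1 + u / s := by
        rw [div_le_iff₀ two_pos]
        have : s ≤ (2 * s + 2 * u) / s := by
          rw [le_div_iff₀ hs0]
          nlinarith [Real.exp_pos (1 / 2 : ℝ)]
        calc s ≤ _ := this
          _ = _ := by field_simp
    _ ≤ 1 + u / g := by gcongr

/-- A truncation order above `2e³ R` makes the tail bound of the Jacobi–Anger series small. -/
theorem tail_le_of_simRate_le {z δ M : ℝ} {k : ℕ} (hz : 0 ≤ z) (hδ : 0 < δ) (hδ2 : δ ^ 2 ≤ 2)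
    (hk : (k : ℝ) = M) (hM1 : 1 ≤ M) (hM : 2 * Real.exp 3 * simRate z δ ≤ M) :
    z ≤ M ∧ (Real.exp 1 * z / M) ^ k ≤ δ ^ 2 / 2 / 3 := by
  have hδp : 0 < δ ^ 2 := by positivity
  have hM0 : 0 < M := by linarith
  -- At `z = 0` the rate is `0` by convention; the tail vanishes because `k ≥ 1`.
  rcases hz.eq_or_lt with rfl | hz
  · refine ⟨hM0.le, ?_⟩
    have : k ≠ 0 := by rintro rfl; simp at hk; linarith
    simp [this]
    positivity
  rw [simRate, if_neg hz.ne'] at hM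
  set ell := Real.log (2 / δ ^ 2) with hell
  have hell0 : 0 ≤ ell := Real.log_nonneg (by rw [le_div_iff₀ hδp]; linarith)
  have hε : Real.exp (-ell) = δ ^ 2 / 2 := by
    rw [hell, Real.exp_neg, Real.exp_log (by positivity), inv_div]
  have hu : 0 ≤ ell / z := by positivity
  obtain ⟨hg, hh⟩ := half_exp_half_log_le hu
  set g := Real.log (Real.exp 1 + ell / z) with hgdef
  have hg0 : 0 < g := by linarith
  have he3 : 1 ≤ Real.exp 3 := Real.one_le_exp (by norm_num)
  have hq : 0 ≤ ell / g := by positivity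
  have hMz : z ≤ M := by nlinarith
  refine ⟨hMz, ?_⟩
  have hMg : 2 * ell ≤ M * g := by
    have : 2 * (ell / g) ≤ M := by nlinarith
    calc 2 * ell = 2 * (ell / g) * g := by field_simp
      _ ≤ _ := by gcongr
  -- In the `M`-th power, `g/2` yields the factor `δ²/2` by `hMg`, and `2` yields `e^{-2} ≤ 1/3`. In
  -- the constant `2e³`, one `e` cancels that of the tail bound and `e²` pays for this last factor.
  have hbase : Real.exp 1 * z / M ≤ Real.exp (-(2 + g / 2)) := by
    have h3 : Real.exp 3 * z * Real.exp (g / 2) ≤ M := by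
      calc Real.exp 3 * z * Real.exp (g / 2)
          = 2 * Real.exp 3 * (z * (Real.exp (g / 2) / 2)) := by ring
        _ ≤ 2 * Real.exp 3 * (z * (1 + ell / z / g)) := by gcongr
        _ = 2 * Real.exp 3 * (z + ell / g) := by field_simp
        _ ≤ M := hM
    rw [div_le_iff₀ hM0, Real.exp_neg, ← div_eq_inv_mul, le_div_iff₀ (Real.exp_pos _), Real.exp_add]
    have : Real.exp 3 = Real.exp 1 * Real.exp 2 := by rw [← Real.exp_add]; norm_num
    rw [this] at h3
    nlinarith
  calc (Real.exp 1 * z / M) ^ k ≤ Real.exp (-(2 + g / 2)) ^ k := by gcongr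
    _ = Real.exp (-(2 * M + M * g / 2)) := by
        rw [← Real.exp_nat_mul, hk]; congr 1; ring
    _ ≤ Real.exp (-ell + -2) := Real.exp_le_exp.mpr (by nlinarith)
    _ = δ ^ 2 / 2 * Real.exp (-2) := by rw [Real.exp_add, hε]
    _ ≤ δ ^ 2 / 2 * (1 / 3) := by
        gcongr
        rw [Real.exp_neg, one_div]
        gcongr
        linarith [Real.add_one_le_exp 2]
    _ = _ := by ring

/-! ### Fejér–Riesz factorization and complementary polynomials -/

open Polynomial in
/-- The reciprocal polynomial `X^N * conj (p (1 / conj X))`. -/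
noncomputable def conjReflect (N : ℕ) (p : ℂ[X]) : ℂ[X] :=
  (p.map (starRingEnd ℂ)).reflect N

open Polynomial in
theorem conjReflect_eval_mul (N : ℕ) {p : ℂ[X]} (hp : p.natDegree ≤ N) {a : ℂ} (ha : a ≠ 0) :
    (conjReflect N p).eval (starRingEnd ℂ a)⁻¹ * (starRingEnd ℂ a) ^ N =
      starRingEnd ℂ (p.eval a) := by
  have ha' : starRingEnd ℂ a ≠ 0 := by simpa using ha
  let _ := invertibleOfNonzero ha'
  have := eval₂_reflect_mul_pow (RingHom.id ℂ) (starRingEnd ℂ a) N (p.map (starRingEnd ℂ))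
    (natDegree_map_le.trans hp)
  rw [invOf_eq_inv] at this
  change eval _ _ * _ = eval _ _ at this
  rw [conjReflect, this, eval_map, eval₂_hom]

theorem conj_eq_inv_of_norm_one {w : ℂ} (hw : ‖w‖ = 1) : starRingEnd ℂ w = w⁻¹ := by
  rw [Complex.inv_def, Complex.normSq_eq_norm_sq, hw]; simp

theorem ne_zero_of_norm_one {w : ℂ} (hw : ‖w‖ = 1) : w ≠ 0 := by
  rintro rfl; simp at hw

-- The circle is fixed by `a ↦ 1 / conj a`. Thus `|p|²` times `w^N` is the polynomial `p *
-- conjReflect N p` there.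
open Polynomial in
theorem conjReflect_eval (N : ℕ) {p : ℂ[X]} (hp : p.natDegree ≤ N) {w : ℂ} (hw : ‖w‖ = 1) :
    (conjReflect N p).eval w = w ^ N * starRingEnd ℂ (p.eval w) := by
  have h0 := ne_zero_of_norm_one hw
  have := conjReflect_eval_mul N hp h0
  rw [conj_eq_inv_of_norm_one hw, inv_inv] at this
  rw [← this, inv_pow, mul_left_comm, mul_inv_cancel₀ (pow_ne_zero _ h0), mul_one]

open Polynomial in
theorem conjReflect_coeff (N : ℕ) (p : ℂ[X]) {i : ℕ} (hi : i ≤ N) :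
    (conjReflect N p).coeff i = starRingEnd ℂ (p.coeff (N - i)) := by
  rw [conjReflect, coeff_reflect, revAt_le hi, coeff_map]

theorem infinite_norm_one : Set.Infinite {w : ℂ | ‖w‖ = 1} := by
  have h : IsPreconnected (Metric.sphere (0 : ℂ) 1) :=
    isPreconnected_sphere (by rw [Complex.rank_real_complex]; norm_num) 0 1
  have := h.infinite_of_nontrivial ⟨1, by simp, -1, by simp, by norm_num⟩
  convert this using 1
  ext w
  simp

open Polynomial in
theorem eq_of_eval_eq_norm_one {p q : ℂ[X]} (h : ∀ w : ℂ, ‖w‖ = 1 → p.eval w = q.eval w) : p = q :=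
  eq_of_infinite_eval_eq p q (infinite_norm_one.mono fun w hw => h w hw)

open Polynomial in
/-- The Fejér–Riesz theorem for strictly positive trigonometric polynomials. -/
theorem exists_norm_sq_eq_of_pos (L : ℕ) : ∀ G : ℂ[X], G.natDegree ≤ 2 * L →
    (∀ w : ℂ, ‖w‖ = 1 → ∃ r : ℝ, 0 < r ∧ G.eval w = w ^ L * r) →
    ∃ q : ℂ[X], q.natDegree ≤ L ∧
      ∀ w : ℂ, ‖w‖ = 1 → G.eval w = w ^ L * ((‖q.eval w‖ ^ 2 : ℝ) : ℂ) := by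
  induction L with
  | zero =>
    intro G hG hpos
    obtain ⟨a, rfl⟩ : ∃ a, G = C a := ⟨_, eq_C_of_natDegree_le_zero (by simpa using hG)⟩
    obtain ⟨r, hr, h⟩ := hpos 1 (by simp)
    simp only [eval_C, pow_zero, one_mul] at h
    refine ⟨C (Real.sqrt r : ℂ), by simp, fun w _ => ?_⟩
    simp only [eval_C, pow_zero, one_mul, h, Complex.norm_real, Real.norm_eq_abs, sq_abs,
      Real.sq_sqrt hr.le]
  | succ L ih =>
    intro G hG hpos
    have hne : ∀ w : ℂ, ‖w‖ = 1 → G.eval w ≠ 0 := by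
      intro w hw
      obtain ⟨r, hr, h⟩ := hpos w hw
      rw [h]
      exact mul_ne_zero (pow_ne_zero _ (ne_zero_of_norm_one hw)) (by exact_mod_cast hr.ne')
    have hG0 : G ≠ 0 := by
      rintro rfl
      exact hne 1 (by simp) (by simp)
    -- `G / w^(L+1)` is real on the circle, so `G` is self-reciprocal: its nonzero roots pair as `a,
    -- 1/conj a`, and its extreme coefficients are conjugate.
    have hself : conjReflect (2 * (L + 1)) G = G := by
      refine eq_of_eval_eq_norm_one fun w hw => ?_
      obtain ⟨r, hr, h⟩ := hpos w hw
      have h0 := ne_zero_of_norm_one hw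
      rw [conjReflect_eval _ hG hw, h, map_mul, map_pow, Complex.conj_ofReal,
        conj_eq_inv_of_norm_one hw, two_mul, pow_add _ (L + 1), inv_pow, ← mul_assoc,
        mul_assoc (w ^ (L + 1)), mul_inv_cancel₀ (pow_ne_zero _ h0), mul_one]
    have htop : G.coeff (2 * (L + 1)) = starRingEnd ℂ (G.coeff 0) := by
      conv_lhs => rw [← hself, conjReflect_coeff _ _ le_rfl, Nat.sub_self]
    -- A zero constant coefficient forces the top one to vanish too. Dividing by `X` then lowers the
    -- degree bound by two and the central power by one.
    by_cases hc : G.coeff 0 = 0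
    · obtain ⟨G', rfl⟩ := X_dvd_iff.mpr hc
      have hG'0 : G' ≠ 0 := right_ne_zero_of_mul hG0
      have hdeg : (X * G').natDegree = G'.natDegree + 1 := natDegree_X_mul hG'0
      have hlt : (X * G').natDegree ≠ 2 * (L + 1) := by
        intro h
        rw [hc, map_zero, ← h] at htop
        exact hG0 (leadingCoeff_eq_zero.mp htop)
      obtain ⟨q, hq, hqe⟩ := ih G' (by omega) (by
        intro w hw
        obtain ⟨r, hr, h⟩ := hpos w hw
        refine ⟨r, hr, mul_left_cancel₀ (ne_zero_of_norm_one hw) ?_⟩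
        rw [eval_mul, eval_X] at h
        rw [h]; ring)
      refine ⟨q, by omega, fun w hw => ?_⟩
      rw [eval_mul, eval_X, hqe w hw]; ring
    · have hdeg : 0 < G.degree := by
        rw [← natDegree_pos_iff_degree_pos]
        have : 2 * (L + 1) ≤ G.natDegree := by
          refine le_natDegree_of_ne_zero ?_
          rw [htop]
          simpa using hc
        omega
      obtain ⟨a, ha⟩ := Complex.exists_root hdeg
      have ha0 : a ≠ 0 := by
        rintro rfl
        exact hc (by rw [coeff_zero_eq_eval_zero]; exact ha)
      have ha0' : starRingEnd ℂ a ≠ 0 := by simpa using ha0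
      have hb : G.eval (starRingEnd ℂ a)⁻¹ = 0 := by
        have := conjReflect_eval_mul _ hG ha0
        rw [hself, ha.eq_zero, map_zero] at this
        exact (mul_eq_zero.mp this).resolve_right (pow_ne_zero _ ha0')
      -- A root equal to its partner would lie on the circle. Strict positivity excludes this, so
      -- both linear factors can be divided out without discussing multiplicities.
      have hab : (starRingEnd ℂ a)⁻¹ ≠ a := by
        intro h
        apply hne a _ ha
        have h1 : a * starRingEnd ℂ a = 1 := by
          nth_rw 1 [← h]; exact inv_mul_cancel₀ ha0'
        rw [Complex.mul_conj, Complex.normSq_eq_norm_sq] at h1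
        have : ‖a‖ ^ 2 = 1 := by exact_mod_cast h1
        exact (pow_eq_one_iff_of_nonneg (norm_nonneg _) two_ne_zero).mp this
      obtain ⟨G₁, rfl⟩ := dvd_iff_isRoot.mpr ha
      have hb₁ : G₁.IsRoot (starRingEnd ℂ a)⁻¹ := by
        rw [eval_mul, eval_sub, eval_X, eval_C] at hb
        exact (mul_eq_zero.mp hb).resolve_left (sub_ne_zero.mpr hab)
      obtain ⟨G₂, rfl⟩ := dvd_iff_isRoot.mpr hb₁
      have h1 : (X - C (starRingEnd ℂ a)⁻¹) * G₂ ≠ 0 := right_ne_zero_of_mul hG0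
      have h2 : G₂ ≠ 0 := right_ne_zero_of_mul h1
      rw [natDegree_mul (X_sub_C_ne_zero _) h1, natDegree_mul (X_sub_C_ne_zero _) h2,
        natDegree_X_sub_C, natDegree_X_sub_C] at hG
      -- On the circle `(w - a)(w - 1/conj a) = -(conj a)⁻¹ w |w - a|²`. The constant goes into the
      -- quotient, which stays positive after the central power is removed.
      have hfac : ∀ w : ℂ, ‖w‖ = 1 →
          eval w ((X - C a) * ((X - C (starRingEnd ℂ a)⁻¹) * G₂)) =
          w * ((‖w - a‖ ^ 2 : ℝ) : ℂ) * eval w (C (-(starRingEnd ℂ a)⁻¹) * G₂) := by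
        intro w hw
        have h0 := ne_zero_of_norm_one hw
        have hn : ((‖w - a‖ ^ 2 : ℝ) : ℂ) = (w - a) * (w⁻¹ - starRingEnd ℂ a) := by
          rw [← conj_eq_inv_of_norm_one hw, ← map_sub, Complex.mul_conj, Complex.normSq_eq_norm_sq]
        rw [hn]
        simp only [eval_mul, eval_sub, eval_X, eval_C]
        field_simp
        ring
      have hwa : ∀ w : ℂ, ‖w‖ = 1 → w - a ≠ 0 := by
        intro w hw h
        apply hne w hw
        rw [eval_mul, eval_sub, eval_X, eval_C, h, zero_mul]
      obtain ⟨q, hq, hqe⟩ := ih (C (-(starRingEnd ℂ a)⁻¹) * G₂)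
        ((natDegree_C_mul_le _ _).trans (by omega)) (by
        intro w hw
        obtain ⟨r, hr, h⟩ := hpos w hw
        have h0 := ne_zero_of_norm_one hw
        have hn : 0 < ‖w - a‖ := norm_pos_iff.mpr (hwa w hw)
        refine ⟨r / ‖w - a‖ ^ 2, by positivity, ?_⟩
        rw [hfac w hw] at h
        have hn' : ((‖w - a‖ ^ 2 : ℝ) : ℂ) ≠ 0 := by exact_mod_cast (by positivity)
        apply mul_left_cancel₀ (mul_ne_zero h0 hn')
        rw [h, Complex.ofReal_div]
        field_simp
        ring)
      refine ⟨(X - C a) * q, ?_, fun w hw => ?_⟩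
      · refine natDegree_mul_le.trans ?_
        rw [natDegree_X_sub_C]; omega
      · rw [hfac w hw, hqe w hw, eval_mul, eval_sub, eval_X, eval_C, norm_mul]
        push_cast
        ring

open Polynomial in
/-- A polynomial that is strictly less than one on the unit circle has a complement. -/
theorem exists_complement {L : ℕ} {p : ℂ[X]} (hp : p.natDegree ≤ L)
    (hlt : ∀ w : ℂ, ‖w‖ = 1 → ‖p.eval w‖ < 1) :
    ∃ q : ℂ[X], q.natDegree ≤ L ∧
      ∀ w : ℂ, ‖w‖ = 1 → ‖p.eval w‖ ^ 2 + ‖q.eval w‖ ^ 2 = 1 := by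
  have hval : ∀ w : ℂ, ‖w‖ = 1 → eval w (X ^ L - p * conjReflect L p) =
      w ^ L * ((1 - ‖p.eval w‖ ^ 2 : ℝ) : ℂ) := by
    intro w hw
    rw [eval_sub, eval_mul, eval_pow, eval_X, conjReflect_eval _ hp hw, Complex.ofReal_sub,
      ← Complex.normSq_eq_norm_sq, ← Complex.mul_conj]
    push_cast
    ring
  obtain ⟨q, hq, hqe⟩ := exists_norm_sq_eq_of_pos L (X ^ L - p * conjReflect L p) (by
      refine (natDegree_sub_le _ _).trans (max_le ?_ ?_)
      · rw [natDegree_X_pow]; omega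
      · have : (conjReflect L p).natDegree ≤ L := by
          refine natDegree_reflect_le.trans (max_le le_rfl (natDegree_map_le.trans hp))
        exact natDegree_mul_le.trans (by omega)) (by
    intro w hw
    refine ⟨_, ?_, hval w hw⟩
    have := hlt w hw
    nlinarith [norm_nonneg (p.eval w)])
  refine ⟨q, hq, fun w hw => ?_⟩
  have := hqe w hw
  rw [hval w hw] at this
  have := mul_left_cancel₀ (pow_ne_zero _ (ne_zero_of_norm_one hw)) this
  have : 1 - ‖p.eval w‖ ^ 2 = ‖q.eval w‖ ^ 2 := by exact_mod_cast this
  linarith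

-- Normalization on the circle is the identity `p p* + q q* = X^(L+1)`, whose constant coefficient
-- is zero. This lets a single rotation lower the degree of both polynomials in `exists_qsp_angles`.
open Polynomial in
theorem coeff_orthogonal {L : ℕ} {p q : ℂ[X]} (hp : p.natDegree ≤ L + 1) (hq : q.natDegree ≤ L + 1)
    (h : ∀ w : ℂ, ‖w‖ = 1 → ‖p.eval w‖ ^ 2 + ‖q.eval w‖ ^ 2 = 1) :
    p.coeff 0 * starRingEnd ℂ (p.coeff (L + 1)) + q.coeff 0 * starRingEnd ℂ (q.coeff (L + 1)) = 0 := by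
  have : p * conjReflect (L + 1) p + q * conjReflect (L + 1) q = X ^ (L + 1) := by
    refine eq_of_eval_eq_norm_one fun w hw => ?_
    have h1 : ((‖p.eval w‖ ^ 2 + ‖q.eval w‖ ^ 2 : ℝ) : ℂ) = 1 := by rw [h w hw]; simp
    rw [Complex.ofReal_add, ← Complex.normSq_eq_norm_sq, ← Complex.normSq_eq_norm_sq,
      ← Complex.mul_conj, ← Complex.mul_conj] at h1
    rw [eval_add, eval_mul, eval_mul, eval_pow, eval_X, conjReflect_eval _ hp hw,
      conjReflect_eval _ hq hw]
    linear_combination w ^ (L + 1) * h1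
  have := congrArg (fun f => coeff f 0) this
  simpa [mul_coeff_zero, conjReflect_coeff, coeff_X_pow] using this

/-! ### Angles of trigonometric quantum signal processing -/

/-- Polar form adapted to the phases of the gates. -/
theorem norm_mul_exp_arg (x : ℂ) : (‖x‖ : ℂ) * Complex.exp (Complex.I * Complex.arg x) = x := by
  rw [mul_comm Complex.I, Complex.norm_mul_exp_arg_mul_I]

/-- `φ` aligns the phases of `x` and `y`; `θ` then rotates the real vector `(|x|, |y|)` onto an
axis. Taking its angle as a complex argument also covers zero entries. -/
theorem exists_angle (x y : ℂ) : ∃ θ φ : ℝ,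
    (Real.sin (θ / 2) : ℂ) * Complex.exp (Complex.I * φ / 2) * x +
      (Real.cos (θ / 2) : ℂ) * Complex.exp (-(Complex.I * φ / 2)) * y = 0 := by
  set ζ : ℂ := ⟨‖x‖, ‖y‖⟩ with hζ
  have h1 : ‖ζ‖ * Real.cos ζ.arg = ‖x‖ := Complex.norm_mul_cos_arg ζ
  have h2 : ‖ζ‖ * Real.sin ζ.arg = ‖y‖ := Complex.norm_mul_sin_arg ζ
  refine ⟨-(2 * ζ.arg), y.arg - x.arg, ?_⟩
  have hx := norm_mul_exp_arg x
  have hy := norm_mul_exp_arg y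
  rw [show -(2 * ζ.arg) / 2 = -ζ.arg by ring, Real.sin_neg, Real.cos_neg]
  have ex : Complex.exp (Complex.I * ((y.arg - x.arg : ℝ) : ℂ) / 2) * x =
      ‖x‖ * Complex.exp (Complex.I * (x.arg + y.arg) / 2) := by
    nth_rw 2 [← hx]
    rw [mul_left_comm, ← Complex.exp_add]
    congr 2; push_cast; ring
  have ey : Complex.exp (-(Complex.I * ((y.arg - x.arg : ℝ) : ℂ) / 2)) * y =
      ‖y‖ * Complex.exp (Complex.I * (x.arg + y.arg) / 2) := by
    nth_rw 2 [← hy]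
    rw [mul_left_comm, ← Complex.exp_add]
    congr 2; push_cast; ring
  rw [mul_assoc, mul_assoc, ex, ey, ← h1, ← h2]
  push_cast
  ring

/-- Annihilating a nonzero `(x, y)` makes it a multiple `k` of a row of the rotation. Orthogonality,
divided by `k`, is the conjugate of the second equation. -/
theorem exists_angle_pair {x y x' y' : ℂ}
    (h : x * starRingEnd ℂ x' + y * starRingEnd ℂ y' = 0) : ∃ θ φ : ℝ,
    (Real.sin (θ / 2) : ℂ) * Complex.exp (Complex.I * φ / 2) * x +
      (Real.cos (θ / 2) : ℂ) * Complex.exp (-(Complex.I * φ / 2)) * y = 0 ∧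
    (Real.cos (θ / 2) : ℂ) * Complex.exp (Complex.I * φ / 2) * x' -
      (Real.sin (θ / 2) : ℂ) * Complex.exp (-(Complex.I * φ / 2)) * y' = 0 := by
  by_cases h0 : x = 0 ∧ y = 0
  · obtain ⟨θ, φ, h1⟩ := exists_angle x' y'
    -- The first equation is void here; shifting `θ` by `π` exchanges sine and cosine and turns the
    -- solution for `(x', y')` into one of the second.
    refine ⟨θ - Real.pi, φ, by simp [h0.1, h0.2], ?_⟩
    rw [sub_div, Real.cos_sub_pi_div_two, Real.sin_sub_pi_div_two]
    push_cast at h1 ⊢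
    linear_combination h1
  · obtain ⟨θ, φ, h1⟩ := exists_angle x y
    refine ⟨θ, φ, h1, ?_⟩
    have hcs : (Real.cos (θ / 2) : ℂ) ^ 2 + (Real.sin (θ / 2) : ℂ) ^ 2 = 1 := by
      exact_mod_cast Real.cos_sq_add_sin_sq (θ / 2)
    have he : Complex.exp (Complex.I * φ / 2) * Complex.exp (-(Complex.I * φ / 2)) = 1 := by
      rw [← Complex.exp_add, add_neg_cancel, Complex.exp_zero]
    have hc1 : starRingEnd ℂ (Complex.exp (Complex.I * φ / 2)) =
        Complex.exp (-(Complex.I * φ / 2)) := by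
      rw [← Complex.exp_conj]; simp [Complex.conj_ofNat, neg_div]
    have hc2 : starRingEnd ℂ (Complex.exp (-(Complex.I * φ / 2))) =
        Complex.exp (Complex.I * φ / 2) := by
      rw [← Complex.exp_conj]; simp [Complex.conj_ofNat, neg_div]
    apply (starRingEnd ℂ).injective
    rw [map_zero, map_sub, map_mul, map_mul, map_mul, map_mul, hc1, hc2, Complex.conj_ofReal,
      Complex.conj_ofReal]
    generalize Complex.exp (Complex.I * φ / 2) = e at *
    generalize Complex.exp (-(Complex.I * φ / 2)) = f at *
    generalize (Real.cos (θ / 2) : ℂ) = c at *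
    generalize (Real.sin (θ / 2) : ℂ) = s at *
    generalize starRingEnd ℂ x' = X at *
    generalize starRingEnd ℂ y' = Y at *
    set k := c * e * x - s * f * y with hk
    have hx : x = c * f * k := by
      linear_combination (-x) * hcs + s * f * h1 - (c ^ 2 + s ^ 2) * x * he
    have hy : y = -(s * e * k) := by
      linear_combination (-y) * hcs + c * e * h1 - (c ^ 2 + s ^ 2) * y * he
    have hk0 : k ≠ 0 := by
      intro hk0
      exact h0 ⟨by rw [hx, hk0, mul_zero], by rw [hy, hk0, mul_zero, neg_zero]⟩
    apply mul_left_cancel₀ hk0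
    rw [hx, hy] at h
    linear_combination h

theorem rotY_mul_rotZ (θ φ : ℝ) : rotY θ * rotZ φ =
    !![Real.cos (θ / 2) * Complex.exp (-(Complex.I * φ / 2)),
        -(Real.sin (θ / 2) * Complex.exp (Complex.I * φ / 2));
      Real.sin (θ / 2) * Complex.exp (-(Complex.I * φ / 2)),
        Real.cos (θ / 2) * Complex.exp (Complex.I * φ / 2)] := by
  ext i j
  fin_cases i <;> fin_cases j <;> simp [rotY, rotZ, Matrix.mul_apply, Fin.sum_univ_two]

theorem qsp_snoc (L : ℕ) (ω : ℝ) (θ φ : Fin (L + 1) → ℝ) (θ' φ' x : ℝ) :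
    qsp (L + 1) ω (Fin.snoc θ θ') (Fin.snoc φ φ') x =
      qsp L ω θ φ x * (rotZ x * (rotY θ' * rotZ φ')) := by
  have h0 : ∀ (f : Fin (L + 1) → ℝ) (a : ℝ),
      (Fin.snoc f a : Fin (L + 1 + 1) → ℝ) 0 = f 0 := fun f a =>
    Fin.snoc_castSucc (α := fun _ => ℝ) a f 0
  have h1 : ∀ (f : Fin (L + 1) → ℝ) (a : ℝ) (l : Fin L),
      (Fin.snoc f a : Fin (L + 1 + 1) → ℝ) l.castSucc.succ = f l.succ := fun f a l =>
    Fin.snoc_castSucc (α := fun _ => ℝ) a f l.succ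
  have h2 : ∀ (f : Fin (L + 1) → ℝ) (a : ℝ),
      (Fin.snoc f a : Fin (L + 1 + 1) → ℝ) (Fin.last L).succ = a := fun f a =>
    Fin.snoc_last (α := fun _ => ℝ) a f
  simp only [qsp, List.ofFn_succ', List.concat_eq_append, List.prod_append, h0, h1, h2,
    List.prod_singleton, Matrix.mul_assoc]

theorem norm_rotation_sq_add {c s : ℝ} {e f : ℂ} (hcs : c ^ 2 + s ^ 2 = 1) (he : ‖e‖ = 1)
    (hf : ‖f‖ = 1) (x y : ℂ) :
    ‖(c : ℂ) * e * x - s * f * y‖ ^ 2 + ‖(s : ℂ) * e * x + c * f * y‖ ^ 2 = ‖x‖ ^ 2 + ‖y‖ ^ 2 := by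
  have hx : ‖e * x‖ = ‖x‖ := by rw [norm_mul, he, one_mul]
  have hy : ‖f * y‖ = ‖y‖ := by rw [norm_mul, hf, one_mul]
  rw [← hx, ← hy, mul_assoc, mul_assoc, mul_assoc, mul_assoc]
  generalize e * x = u
  generalize f * y = v
  simp only [← Complex.normSq_eq_norm_sq, Complex.normSq_apply, Complex.add_re, Complex.add_im,
    Complex.sub_re, Complex.sub_im, Complex.re_ofReal_mul, Complex.im_ofReal_mul]
  linear_combination (u.re ^ 2 + u.im ^ 2 + v.re ^ 2 + v.im ^ 2) * hcs

theorem norm_exp_I_half (φ : ℝ) : ‖Complex.exp (Complex.I * φ / 2)‖ = 1 := by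
  rw [show Complex.I * φ / 2 = ((φ / 2 : ℝ) : ℂ) * Complex.I by push_cast; ring]
  exact Complex.norm_exp_ofReal_mul_I _

theorem norm_exp_neg_I_half (φ : ℝ) : ‖Complex.exp (-(Complex.I * φ / 2))‖ = 1 := by
  rw [show -(Complex.I * φ / 2) = Complex.I * ((-φ : ℝ) : ℂ) / 2 by push_cast; ring]
  exact norm_exp_I_half _

open Polynomial in
/-- Trigonometric quantum signal processing: every normalized pair of polynomials of degree at most
`L` is the first row of a product of `L` signal rotations interleaved with processing rotations. -/
theorem exists_qsp_angles (L : ℕ) : ∀ p q : ℂ[X], p.natDegree ≤ L → q.natDegree ≤ L →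
    (∀ w : ℂ, ‖w‖ = 1 → ‖p.eval w‖ ^ 2 + ‖q.eval w‖ ^ 2 = 1) →
    ∃ (ω : ℝ) (θ φ : Fin (L + 1) → ℝ), ∀ x : ℝ,
      qsp L ω θ φ x 0 0 =
        Complex.exp (-(Complex.I * x / 2)) ^ L * p.eval (Complex.exp (Complex.I * x)) ∧
      qsp L ω θ φ x 0 1 =
        Complex.exp (-(Complex.I * x / 2)) ^ L * q.eval (Complex.exp (Complex.I * x)) := by
  induction L with
  | zero =>
    intro p q hp hq h
    obtain ⟨a, rfl⟩ : ∃ a, p = C a := ⟨_, eq_C_of_natDegree_le_zero hp⟩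
    obtain ⟨b, rfl⟩ : ∃ b, q = C b := ⟨_, eq_C_of_natDegree_le_zero hq⟩
    have hab : ‖a‖ ^ 2 + ‖b‖ ^ 2 = 1 := by simpa using h 1 (by simp)
    set ζ : ℂ := ⟨‖a‖, ‖b‖⟩ with hζ
    have hn : ‖ζ‖ = 1 := by
      rw [← pow_eq_one_iff_of_nonneg (norm_nonneg _) two_ne_zero, ← Complex.normSq_eq_norm_sq,
        Complex.normSq_apply, hζ]
      simp only
      linarith
    have h1 : Real.cos ζ.arg = ‖a‖ := by have := Complex.norm_mul_cos_arg ζ; rwa [hn, one_mul] at this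
    have h2 : Real.sin ζ.arg = ‖b‖ := by have := Complex.norm_mul_sin_arg ζ; rwa [hn, one_mul] at this
    -- The half-angle phases `-(ω + φ)/2` and `(φ - ω)/2` must be the arguments of `a` and `b`; the
    -- negative `θ` cancels the sign of the upper right entry of `R_y`.
    refine ⟨-(a.arg + b.arg), fun _ => -(2 * ζ.arg), fun _ => b.arg - a.arg, fun x => ?_⟩
    simp only [qsp, List.ofFn_zero, List.prod_nil, mul_one, mul_assoc, rotY_mul_rotZ, pow_zero,
      one_mul, eval_C]
    rw [show -(2 * ζ.arg) / 2 = -ζ.arg by ring, Real.sin_neg, Real.cos_neg, h1, h2]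
    simp only [rotZ, Matrix.mul_apply, Fin.sum_univ_two]
    simp only [Matrix.of_apply, Matrix.cons_val', Matrix.cons_val_zero, Matrix.cons_val_one,
      Matrix.cons_val_fin_one, zero_mul, add_zero]
    constructor
    · conv_rhs => rw [← norm_mul_exp_arg a]
      rw [mul_left_comm, ← Complex.exp_add]
      congr 2
      push_cast; ring
    · conv_rhs => rw [← norm_mul_exp_arg b]
      rw [Complex.ofReal_neg ‖b‖, neg_mul, neg_neg, mul_left_comm, ← Complex.exp_add]
      congr 2
      push_cast; ring
  | succ L ih =>
    intro p q hp hq h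
    -- Undoing the last processing rotation must remove the top coefficient of the first entry and
    -- the constant coefficient of the second.
    obtain ⟨θ', φ', h1, h2⟩ := exists_angle_pair (coeff_orthogonal hp hq h)
    have hcs : (Real.cos (θ' / 2)) ^ 2 + (Real.sin (θ' / 2)) ^ 2 = 1 :=
      Real.cos_sq_add_sin_sq (θ' / 2)
    have hcs' : (Real.cos (θ' / 2) : ℂ) ^ 2 + (Real.sin (θ' / 2) : ℂ) ^ 2 = 1 := by
      exact_mod_cast hcs
    have hef : Complex.exp (Complex.I * φ' / 2) * Complex.exp (-(Complex.I * φ' / 2)) = 1 := by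
      rw [← Complex.exp_add, add_neg_cancel, Complex.exp_zero]
    have hrot := rotY_mul_rotZ θ' φ'
    have hne := norm_exp_I_half φ'
    have hnf := norm_exp_neg_I_half φ'
    set e := Complex.exp (Complex.I * φ' / 2) with he
    set f := Complex.exp (-(Complex.I * φ' / 2)) with hf
    set c := Real.cos (θ' / 2) with hc
    set s := Real.sin (θ' / 2) with hs
    clear_value e f c s
    set p' : ℂ[X] := C ((c : ℂ) * e) * p - C ((s : ℂ) * f) * q with hp'
    set r : ℂ[X] := C ((s : ℂ) * e) * p + C ((c : ℂ) * f) * q with hr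
    have hr0 : r.coeff 0 = 0 := by
      rw [hr, coeff_add, coeff_C_mul, coeff_C_mul]; exact h1
    have hpc : p'.coeff (L + 1) = 0 := by
      rw [hp', coeff_sub, coeff_C_mul, coeff_C_mul]; exact h2
    have hp'd : p'.natDegree ≤ L + 1 :=
      (natDegree_sub_le _ _).trans (max_le ((natDegree_C_mul_le _ _).trans hp)
        ((natDegree_C_mul_le _ _).trans hq))
    have hrd : r.natDegree ≤ L + 1 :=
      (natDegree_add_le _ _).trans (max_le ((natDegree_C_mul_le _ _).trans hp)
        ((natDegree_C_mul_le _ _).trans hq))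
    -- Division by `X` undoes the signal rotation: relative to the prefactor `e^{-ix/2}`, `R_z(x)`
    -- fixes the first entry and multiplies the second by `e^{ix}`.
    obtain ⟨q', hq'⟩ := X_dvd_iff.mpr hr0
    have hp'L : p'.natDegree ≤ L := by
      by_contra hcon
      have : p'.natDegree = L + 1 := by omega
      rw [← this] at hpc
      have := leadingCoeff_eq_zero.mp hpc
      rw [this] at hcon
      simp at hcon
    have hq'L : q'.natDegree ≤ L := by
      by_cases h0 : q' = 0
      · simp [h0]
      · rw [hq', natDegree_X_mul h0] at hrd; omega
    obtain ⟨ω, θ, φ, hang⟩ := ih p' q' hp'L hq'L (by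
      intro w hw
      have hrw : ‖q'.eval w‖ = ‖r.eval w‖ := by
        rw [hq', eval_mul, eval_X, norm_mul, hw, one_mul]
      rw [hrw, ← h w hw, hp', hr]
      simp only [eval_add, eval_sub, eval_mul, eval_C]
      exact norm_rotation_sq_add hcs hne hnf _ _)
    refine ⟨ω, Fin.snoc θ θ', Fin.snoc φ φ', fun x => ?_⟩
    obtain ⟨ha, hb⟩ := hang x
    have hww : Complex.exp (Complex.I * x / 2) =
        Complex.exp (-(Complex.I * x / 2)) * Complex.exp (Complex.I * x) := by
      rw [← Complex.exp_add]; congr 1; ring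
    have hqw : Complex.exp (Complex.I * x) * q'.eval (Complex.exp (Complex.I * x)) =
        r.eval (Complex.exp (Complex.I * x)) := by
      rw [hq', eval_mul, eval_X]
    have hpe : p'.eval (Complex.exp (Complex.I * x)) =
        c * e * p.eval (Complex.exp (Complex.I * x)) -
        s * f * q.eval (Complex.exp (Complex.I * x)) := by
      rw [hp']; simp only [eval_sub, eval_mul, eval_C]
    have hre : r.eval (Complex.exp (Complex.I * x)) =
        s * e * p.eval (Complex.exp (Complex.I * x)) +
        c * f * q.eval (Complex.exp (Complex.I * x)) := by
      rw [hr]; simp only [eval_add, eval_mul, eval_C]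
    rw [qsp_snoc, hrot]
    simp only [rotZ, Matrix.mul_apply, Fin.sum_univ_two, ha, hb]
    simp only [Matrix.of_apply, Matrix.cons_val', Matrix.cons_val_zero, Matrix.cons_val_one,
      Matrix.cons_val_fin_one, zero_mul, add_zero, zero_add, hww, pow_succ]
    generalize p.eval (Complex.exp (Complex.I * x)) = P at *
    generalize q.eval (Complex.exp (Complex.I * x)) = Q at *
    generalize q'.eval (Complex.exp (Complex.I * x)) = Q' at *
    generalize p'.eval (Complex.exp (Complex.I * x)) = P' at *
    generalize r.eval (Complex.exp (Complex.I * x)) = R at *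
    generalize Complex.exp (Complex.I * x) = w at *
    generalize Complex.exp (-(Complex.I * x / 2)) = v at *
    rw [hre] at hqw
    constructor
    · linear_combination v ^ L * v * (c * f * hpe + s * f * hqw + P * (e * f) * hcs' + P * hef)
    · linear_combination v ^ L * v * (-s * e * hpe + c * e * hqw + Q * (e * f) * hcs' + Q * hef)

/-! ### Block-diagonal calculus of controlled gates -/

section Controlled

variable {ι : Type*}

/-- The block-diagonal operator applying `V b` when the control qubit is `|b⟩`. -/
def multiplexer (V W : Matrix ι ι ℂ) : Matrix (Fin 2 × ι) (Fin 2 × ι) ℂ :=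
  Matrix.single 0 0 (1 : ℂ) ⊗ₖ V + Matrix.single 1 1 (1 : ℂ) ⊗ₖ W

theorem single_add_single :
    (Matrix.single 0 0 (1 : ℂ) + Matrix.single 1 1 (1 : ℂ) : Matrix (Fin 2) (Fin 2) ℂ) = 1 := by
  ext i j
  fin_cases i <;> fin_cases j <;> simp

theorem one_kronecker_eq (V : Matrix ι ι ℂ) :
    (1 : Matrix (Fin 2) (Fin 2) ℂ) ⊗ₖ V = multiplexer V V := by
  rw [multiplexer, ← Matrix.add_kronecker, single_add_single]

theorem conjTranspose_multiplexer (V W : Matrix ι ι ℂ) :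
    (multiplexer V W)ᴴ = multiplexer Vᴴ Wᴴ := by
  simp [multiplexer, Matrix.conjTranspose_kronecker]

theorem multiplexer_mul [Fintype ι] (V W V' W' : Matrix ι ι ℂ) :
    multiplexer V W * multiplexer V' W' = multiplexer (V * V') (W * W') := by
  simp [multiplexer, Matrix.add_mul, Matrix.mul_add, ← Matrix.mul_kronecker_mul]

variable [DecidableEq ι]

theorem ctrl_zero_eq (V : Matrix ι ι ℂ) : ctrl 0 V = multiplexer V 1 := by
  rw [ctrl, multiplexer]
  congr 2
  rw [sub_eq_iff_eq_add, add_comm, single_add_single]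

theorem ctrl_one_eq (V : Matrix ι ι ℂ) : ctrl 1 V = multiplexer 1 V := by
  rw [ctrl, multiplexer, add_comm]
  congr 2
  rw [sub_eq_iff_eq_add, single_add_single]

theorem multiplexer_one : multiplexer (1 : Matrix ι ι ℂ) 1 = 1 := by
  rw [← one_kronecker_eq, Matrix.one_kronecker_one]

theorem conjTranspose_pauliX_kronecker :
    (pauliX ⊗ₖ (1 : Matrix ι ι ℂ))ᴴ = pauliX ⊗ₖ (1 : Matrix ι ι ℂ) := by
  rw [Matrix.conjTranspose_kronecker, Matrix.conjTranspose_one]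
  congr 1
  ext i j
  fin_cases i <;> fin_cases j <;> simp [pauliX]

theorem conjTranspose_hadamard_kronecker :
    (hadamard ⊗ₖ (1 : Matrix ι ι ℂ))ᴴ = hadamard ⊗ₖ (1 : Matrix ι ι ℂ) := by
  rw [Matrix.conjTranspose_kronecker, Matrix.conjTranspose_one]
  congr 1
  ext i j
  fin_cases i <;> fin_cases j <;> simp [hadamard]

variable [Fintype ι]

theorem kronecker_one_mul (A B : Matrix (Fin 2) (Fin 2) ℂ) :
    A ⊗ₖ (1 : Matrix ι ι ℂ) * B ⊗ₖ (1 : Matrix ι ι ℂ) = (A * B) ⊗ₖ (1 : Matrix ι ι ℂ) := by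
  rw [← Matrix.mul_kronecker_mul, Matrix.one_mul]

theorem pauliX_mul_multiplexer (V W : Matrix ι ι ℂ) :
    pauliX ⊗ₖ (1 : Matrix ι ι ℂ) * multiplexer V W =
      multiplexer W V * pauliX ⊗ₖ (1 : Matrix ι ι ℂ) := by
  simp only [multiplexer, Matrix.add_mul, Matrix.mul_add, ← Matrix.mul_kronecker_mul,
    Matrix.one_mul, Matrix.mul_one]
  rw [add_comm]
  congr 2 <;> ext i j <;> fin_cases i <;> fin_cases j <;>
    simp [pauliX, Matrix.mul_apply, Matrix.single_apply]

theorem pauliX_kronecker_sq :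
    pauliX ⊗ₖ (1 : Matrix ι ι ℂ) * pauliX ⊗ₖ (1 : Matrix ι ι ℂ) = 1 := by
  have : pauliX * pauliX = 1 := by
    ext i j
    fin_cases i <;> fin_cases j <;> simp [pauliX, Matrix.mul_apply]
  rw [kronecker_one_mul, this, Matrix.one_kronecker_one]

theorem hadamard_kronecker_sq :
    hadamard ⊗ₖ (1 : Matrix ι ι ℂ) * hadamard ⊗ₖ (1 : Matrix ι ι ℂ) = 1 := by
  have h2 : (Real.sqrt 2 : ℂ) * Real.sqrt 2 = 2 := by
    exact_mod_cast Real.mul_self_sqrt (by norm_num)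
  have h : hadamard * hadamard = 1 := by
    rw [hadamard, Matrix.smul_mul, Matrix.mul_smul, smul_smul]
    have : (((1 / Real.sqrt 2 : ℝ) : ℂ) * ((1 / Real.sqrt 2 : ℝ) : ℂ)) = 1 / 2 := by
      push_cast
      rw [div_mul_div_comm, h2, one_mul]
    rw [this]
    ext i j
    fin_cases i <;> fin_cases j <;> simp <;> norm_num
  rw [kronecker_one_mul, h, Matrix.one_kronecker_one]

end Controlled

/-! ### The qubitized encoding and its circuit -/

section Qubitization

variable {m n : ℕ}

/-- The self-inverse block encoding of the Hermitian part, without the reflection. -/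
noncomputable def qubitizeCore (U : Matrix (BlockReg m n) (BlockReg m n) ℂ) :
    Matrix (Fin 2 × BlockReg m n) (Fin 2 × BlockReg m n) ℂ :=
  hadamard ⊗ₖ (1 : Matrix (BlockReg m n) (BlockReg m n) ℂ) *
    (pauliX ⊗ₖ (1 : Matrix (BlockReg m n) (BlockReg m n) ℂ) * multiplexer U Uᴴ) *
    hadamard ⊗ₖ (1 : Matrix (BlockReg m n) (BlockReg m n) ℂ)

theorem qubitize_eq (U : Matrix (BlockReg m n) (BlockReg m n) ℂ) :
    qubitize U = reflector m n * qubitizeCore U := by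
  rw [qubitize, qubitizeCore, ctrl_zero_eq, ctrl_one_eq, Matrix.mul_assoc _ (multiplexer _ _)
    (multiplexer _ _), multiplexer_mul, Matrix.one_mul, Matrix.mul_one]
  simp only [Matrix.mul_assoc]

theorem conjTranspose_qubitizeCore (U : Matrix (BlockReg m n) (BlockReg m n) ℂ) :
    (qubitizeCore U)ᴴ = qubitizeCore U := by
  simp only [qubitizeCore, Matrix.conjTranspose_mul, conjTranspose_hadamard_kronecker,
    conjTranspose_pauliX_kronecker, conjTranspose_multiplexer, Matrix.conjTranspose_conjTranspose,
    pauliX_mul_multiplexer, Matrix.mul_assoc]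

/-- Moving `X` across the multiplexer swaps `U` and `Uᴴ`, so each block meets its inverse. -/
theorem qubitizeCore_sq {U : Matrix (BlockReg m n) (BlockReg m n) ℂ}
    (hU : U ∈ Matrix.unitaryGroup (BlockReg m n) ℂ) : qubitizeCore U * qubitizeCore U = 1 := by
  have h1 : U * Uᴴ = 1 := (Matrix.mem_unitaryGroup_iff).mp hU
  have h2 : Uᴴ * U = 1 := (Matrix.mem_unitaryGroup_iff').mp hU
  have hmid : (pauliX ⊗ₖ (1 : Matrix (BlockReg m n) (BlockReg m n) ℂ) * multiplexer U Uᴴ) *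
      (pauliX ⊗ₖ (1 : Matrix (BlockReg m n) (BlockReg m n) ℂ) * multiplexer U Uᴴ) = 1 := by
    nth_rw 1 [pauliX_mul_multiplexer]
    rw [Matrix.mul_assoc, ← Matrix.mul_assoc _ _ (multiplexer U Uᴴ), pauliX_kronecker_sq,
      Matrix.one_mul, multiplexer_mul, h1, h2, multiplexer_one]
  have hh := hadamard_kronecker_sq (ι := BlockReg m n)
  rw [qubitizeCore]
  generalize pauliX ⊗ₖ (1 : Matrix (BlockReg m n) (BlockReg m n) ℂ) * multiplexer U Uᴴ = A at *
  generalize hadamard ⊗ₖ (1 : Matrix (BlockReg m n) (BlockReg m n) ℂ) = h at *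
  calc h * A * h * (h * A * h) = h * (A * (h * h) * A) * h := by simp only [Matrix.mul_assoc]
    _ = 1 := by rw [hh, Matrix.mul_one, hmid, Matrix.mul_one, hh]

theorem reflector_sq : reflector m n * reflector m n = 1 := by
  rw [reflector, Matrix.diagonal_mul_diagonal, ← Matrix.diagonal_one]
  congr 1
  ext p
  split_ifs <;> simp

theorem conjTranspose_reflector : (reflector m n)ᴴ = reflector m n := by
  rw [reflector, Matrix.diagonal_conjTranspose]
  congr 1
  ext p
  simp only [Pi.star_apply]
  split_ifs <;> simp

theorem conjTranspose_qubitize (U : Matrix (BlockReg m n) (BlockReg m n) ℂ) :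
    (qubitize U)ᴴ = qubitizeCore U * reflector m n := by
  rw [qubitize_eq, Matrix.conjTranspose_mul, conjTranspose_qubitizeCore, conjTranspose_reflector]

theorem qubitize_mem_unitary {U : Matrix (BlockReg m n) (BlockReg m n) ℂ}
    (hU : U ∈ Matrix.unitaryGroup (BlockReg m n) ℂ) :
    qubitize U ∈ Matrix.unitaryGroup (Fin 2 × BlockReg m n) ℂ := by
  rw [Matrix.mem_unitaryGroup_iff, Matrix.star_eq_conjTranspose, conjTranspose_qubitize,
    qubitize_eq, Matrix.mul_assoc, ← Matrix.mul_assoc (qubitizeCore U), qubitizeCore_sq hU,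
    Matrix.one_mul, reflector_sq]

/-- This is the inactive branch of the control. Once the `X` gates and the reflection are switched
off, the two queries cancel, so the queries need no control by the QPP ancilla. -/
theorem hadamard_mul_queries_mul_hadamard {U : Matrix (BlockReg m n) (BlockReg m n) ℂ}
    (hU : U ∈ Matrix.unitaryGroup (BlockReg m n) ℂ) :
    hadamard ⊗ₖ (1 : Matrix (BlockReg m n) (BlockReg m n) ℂ) * (multiplexer 1 Uᴴ *
      (multiplexer 1 U * hadamard ⊗ₖ (1 : Matrix (BlockReg m n) (BlockReg m n) ℂ))) = 1 := by
  have h2 : Uᴴ * U = 1 := (Matrix.mem_unitaryGroup_iff').mp hU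
  rw [← Matrix.mul_assoc (multiplexer 1 Uᴴ), multiplexer_mul, h2, Matrix.one_mul, multiplexer_one,
    Matrix.one_mul, hadamard_kronecker_sq]

/-- In the active branch, two of the `X` gates conjugate controlled-`U` into open-controlled-`U`;
the third is the `X` of the qubitization. -/
theorem ctrlQubitized_eval {U : Matrix (BlockReg m n) (BlockReg m n) ℂ}
    (hU : U ∈ Matrix.unitaryGroup (BlockReg m n) ℂ) :
    ctrlQubitized.eval U = ctrl 1 (qubitize U) := by
  simp only [Circuit.eval, ctrlQubitized, List.map_cons, List.map_nil, List.prod_cons,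
    List.prod_nil, mul_one, Gate.eval, one_kronecker_eq, ctrl_one_eq, multiplexer_mul,
    Matrix.one_mul]
  rw [qubitize_eq, qubitizeCore]
  congr 2
  · exact hadamard_mul_queries_mul_hadamard hU
  have : multiplexer U Uᴴ = multiplexer 1 Uᴴ * multiplexer U 1 := by
    rw [multiplexer_mul, Matrix.one_mul, Matrix.mul_one]
  rw [this, Matrix.mul_assoc, Matrix.mul_assoc, Matrix.mul_assoc,
    ← Matrix.mul_assoc (multiplexer 1 U), ← pauliX_mul_multiplexer U 1]
  simp only [Matrix.mul_assoc]
  rw [← Matrix.mul_assoc (pauliX ⊗ₖ 1) (pauliX ⊗ₖ 1), pauliX_kronecker_sq, Matrix.one_mul]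

/-- The core is Hermitian, so taking the adjoint only moves the reflection to the other side and the
query order is unchanged. -/
theorem openCtrlQubitizedAdj_eval {U : Matrix (BlockReg m n) (BlockReg m n) ℂ}
    (hU : U ∈ Matrix.unitaryGroup (BlockReg m n) ℂ) :
    openCtrlQubitizedAdj.eval U = ctrl 0 (qubitize U)ᴴ := by
  simp only [Circuit.eval, openCtrlQubitizedAdj, List.map_cons, List.map_nil, List.prod_cons,
    List.prod_nil, mul_one, Gate.eval, one_kronecker_eq, ctrl_one_eq, ctrl_zero_eq,
    multiplexer_mul, Matrix.one_mul]
  rw [conjTranspose_qubitize, qubitizeCore]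
  congr 1
  swap
  · exact hadamard_mul_queries_mul_hadamard hU
  have : multiplexer U Uᴴ = multiplexer 1 Uᴴ * multiplexer U 1 := by
    rw [multiplexer_mul, Matrix.one_mul, Matrix.mul_one]
  rw [this]
  simp only [Matrix.mul_assoc]
  congr 3
  rw [← Matrix.mul_assoc (pauliX ⊗ₖ 1) (multiplexer 1 U), pauliX_mul_multiplexer 1 U,
    Matrix.mul_assoc, ← Matrix.mul_assoc (pauliX ⊗ₖ 1) (pauliX ⊗ₖ 1), pauliX_kronecker_sq,
    Matrix.one_mul]

theorem Circuit_eval_append (K K' : Circuit) (U : Matrix (BlockReg m n) (BlockReg m n) ℂ) :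
    Circuit.eval (K ++ K') U = Circuit.eval K U * Circuit.eval K' U := by
  rw [Circuit.eval, List.map_append, List.prod_append]; rfl

theorem Circuit_eval_flatten_ofFn {L : ℕ} (K : Fin L → Circuit)
    (U : Matrix (BlockReg m n) (BlockReg m n) ℂ) :
    Circuit.eval (List.ofFn K).flatten U = (List.ofFn fun l => (K l).eval U).prod := by
  rw [Circuit.eval, List.map_flatten, List.prod_flatten, List.map_ofFn, List.map_ofFn]
  rfl

theorem simCircuit_eval (L : ℕ) (ω : ℝ) (θ φ : Fin (L + 1) → ℝ)
    {U : Matrix (BlockReg m n) (BlockReg m n) ℂ}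
    (hU : U ∈ Matrix.unitaryGroup (BlockReg m n) ℂ) :
    (simCircuit L ω θ φ).eval U = qpp L ω θ φ (qubitize U) := by
  have hpair : ∀ a b : ℝ, Circuit.eval [Gate.ry a, Gate.rz b] U = (rotY a * rotZ b) ⊗ₖ 1 := by
    intro a b
    simp only [Circuit.eval, List.map_cons, List.map_nil, List.prod_cons,
      List.prod_nil, mul_one, Gate.eval, kronecker_one_mul]
  rw [simCircuit, Circuit_eval_append, Circuit_eval_flatten_ofFn, qpp]
  congr 1
  · simp only [Circuit.eval, List.map_cons, List.map_nil, List.prod_cons,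
      List.prod_nil, mul_one, Gate.eval, kronecker_one_mul, Matrix.mul_assoc]
  · congr 2
    ext1 l
    rw [Circuit_eval_append, hpair]
    congr 1
    split_ifs
    · exact openCtrlQubitizedAdj_eval hU
    · exact ctrlQubitized_eval hU

theorem simCircuit_queryCount (L : ℕ) (ω : ℝ) (θ φ : Fin (L + 1) → ℝ) :
    (simCircuit L ω θ φ).queryCount = 2 * L := by
  have hl : ∀ l : Fin L, (List.map Gate.cost
      ((if Even (l : ℕ) then openCtrlQubitizedAdj else ctrlQubitized) ++
        [Gate.ry (θ l.succ), Gate.rz (φ l.succ)])).sum = 2 := by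
    intro l
    split_ifs <;> simp [openCtrlQubitizedAdj, ctrlQubitized, Gate.cost]
  rw [Circuit.queryCount, simCircuit, List.map_append, List.sum_append, List.map_flatten,
    List.sum_flatten, List.map_ofFn, List.map_ofFn, List.sum_ofFn]
  simp only [Function.comp_apply, hl]
  simp [Gate.cost, mul_comm]

/-- The isometry `|0^{m+1}⟩ ⊗ I` from the system into the register of the qubitized encoding. -/
def initBlock (m n : ℕ) : Matrix (Fin 2 × BlockReg m n) (Qubits n) ℂ :=
  Matrix.of fun p j => if p.1 = 0 ∧ p.2.1 = 0 ∧ p.2.2 = j then 1 else 0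

theorem mul_initBlock_apply {κ : Type*} (S : Matrix κ (Fin 2 × BlockReg m n) ℂ)
    (p : κ) (j : Qubits n) : (S * initBlock m n) p j = S p (0, 0, j) := by
  rw [Matrix.mul_apply, Finset.sum_eq_single (0, 0, j)]
  · simp [initBlock]
  · rintro ⟨a, b, c⟩ _ hne
    rw [initBlock, Matrix.of_apply, if_neg, mul_zero]
    rintro ⟨h1, h2, h3⟩
    exact hne (by simp only at h1 h2 h3; rw [h1, h2, h3])
  · simp

theorem initBlock_mul_apply (S : Matrix (Qubits n) (Qubits n) ℂ)
    (p : Fin 2 × BlockReg m n) (j : Qubits n) : (initBlock m n * S) p j =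
      if p.1 = 0 ∧ p.2.1 = 0 then S p.2.2 j else 0 := by
  rw [Matrix.mul_apply]
  by_cases h : p.1 = 0 ∧ p.2.1 = 0
  · simp [initBlock, h.1, h.2]
  · rw [if_neg h]
    refine Finset.sum_eq_zero fun c _ => ?_
    rw [initBlock, Matrix.of_apply, if_neg, zero_mul]
    exact fun h' => h ⟨h'.1, h'.2.1⟩

theorem conjTranspose_initBlock_mul : (initBlock m n)ᴴ * initBlock m n = 1 := by
  ext i j
  rw [mul_initBlock_apply, Matrix.conjTranspose_apply, initBlock, Matrix.of_apply, Matrix.one_apply]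
  simp [eq_comm]

theorem reflector_mul_initBlock : reflector m n * initBlock m n = initBlock m n := by
  ext p j
  rw [reflector, Matrix.diagonal_mul, initBlock, Matrix.of_apply]
  split_ifs <;> simp_all

theorem kronecker_sandwich_apply {ι : Type*} [Fintype ι] [DecidableEq ι]
    (A B : Matrix (Fin 2) (Fin 2) ℂ) (V W : Matrix ι ι ℂ) (i j : Fin 2) (a b : ι) :
    (A ⊗ₖ (1 : Matrix ι ι ℂ) * multiplexer V W * B ⊗ₖ (1 : Matrix ι ι ℂ)) (i, a) (j, b) =
      A i 0 * B 0 j * V a b + A i 1 * B 1 j * W a b := by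
  simp only [multiplexer, Matrix.add_mul, Matrix.mul_add, ← Matrix.mul_kronecker_mul,
    Matrix.one_mul, Matrix.mul_one, Matrix.add_apply, Matrix.kronecker_apply]
  simp [Matrix.mul_apply, Fin.sum_univ_two, Matrix.single_apply]

theorem qubitizeCore_apply (U : Matrix (BlockReg m n) (BlockReg m n) ℂ) (a b : BlockReg m n) :
    qubitizeCore U (0, a) (0, b) = (U a b + Uᴴ a b) / 2 := by
  have h2 : (Real.sqrt 2 : ℂ) * Real.sqrt 2 = 2 := by
    exact_mod_cast Real.mul_self_sqrt (by norm_num)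
  have h3 : (Real.sqrt 2 : ℂ)⁻¹ * (Real.sqrt 2 : ℂ)⁻¹ = 2⁻¹ := by rw [← mul_inv, h2]
  rw [qubitizeCore, ← Matrix.mul_assoc, kronecker_one_mul, kronecker_sandwich_apply]
  simp [hadamard, pauliX, Matrix.mul_apply, h3]
  ring

/-- With core `C`, reflection `R` and isometry `E`, `R E = E` gives `(R C + C R) E = (R + 1) C E`,
which is twice the projection of `C E` onto the initial subspace. The corner of `C` averages `U` and
`Uᴴ`, hence equals `H`. -/
theorem qubitize_add_conjTranspose_mul_initBlock {H : Matrix (Qubits n) (Qubits n) ℂ}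
    (hH : H.IsHermitian) {U : Matrix (BlockReg m n) (BlockReg m n) ℂ}
    (hU : ∀ i j, U (0, i) (0, j) = H i j) :
    (qubitize U + (qubitize U)ᴴ) * initBlock m n = initBlock m n * ((2 : ℂ) • H) := by
  rw [conjTranspose_qubitize, qubitize_eq, Matrix.add_mul, Matrix.mul_assoc, Matrix.mul_assoc,
    reflector_mul_initBlock]
  ext p j
  rw [Matrix.add_apply, initBlock_mul_apply, reflector, Matrix.diagonal_mul, mul_initBlock_apply]
  by_cases hp : p.1 = 0 ∧ p.2.1 = 0
  · obtain ⟨a, b, i⟩ := p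
    obtain ⟨rfl, rfl⟩ := hp
    rw [if_pos ⟨rfl, rfl⟩, if_pos ⟨rfl, rfl⟩, qubitizeCore_apply, Matrix.conjTranspose_apply, hU, hU,
      hH.apply, Matrix.smul_apply, smul_eq_mul]
    ring
  · rw [if_neg hp, if_neg hp]
    ring

end Qubitization

/-! ### Phase processing over a general star algebra -/

section Signal

variable {A A' : Type*} [Ring A] [StarRing A] [Algebra ℂ A] [Ring A'] [StarRing A'] [Algebra ℂ A']

/-- Phase processing with the signal in an arbitrary star algebra, as a `2 × 2` matrix over it. -/
noncomputable def qppAlg (L : ℕ) (ω : ℝ) (θ φ : Fin (L + 1) → ℝ) (v : A) :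
    Matrix (Fin 2) (Fin 2) A :=
  (rotZ ω * rotY (θ 0) * rotZ (φ 0)).map (algebraMap ℂ A) *
    (List.ofFn fun l : Fin L =>
      (if Even (l : ℕ) then !![star v, 0; 0, 1] else !![1, 0; 0, v]) *
        (rotY (θ l.succ) * rotZ (φ l.succ)).map (algebraMap ℂ A)).prod

/-- This naturality links the three uses of the formula: functions on the spectrum, their values at
a point, and matrices. -/
theorem qppAlg_map (Ψ : A →⋆ₐ[ℂ] A') (L : ℕ) (ω : ℝ) (θ φ : Fin (L + 1) → ℝ) (v : A) :
    (qppAlg L ω θ φ v).map Ψ = qppAlg L ω θ φ (Ψ v) := by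
  let F : Matrix (Fin 2) (Fin 2) A →+* Matrix (Fin 2) (Fin 2) A' :=
    (Ψ : A →ₐ[ℂ] A').toRingHom.mapMatrix
  have hF : ∀ M : Matrix (Fin 2) (Fin 2) A, M.map Ψ = F M := fun M => rfl
  have hc : ∀ M : Matrix (Fin 2) (Fin 2) ℂ,
      F (M.map (algebraMap ℂ A)) = M.map (algebraMap ℂ A') := by
    intro M
    ext i j
    exact AlgHomClass.commutes Ψ (M i j)
  rw [hF, qppAlg, qppAlg, map_mul, hc, map_list_prod, List.map_ofFn]
  congr 3
  ext1 l
  rw [Function.comp_apply, map_mul, hc]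
  congr 1
  split_ifs <;> ext i j <;> fin_cases i <;> fin_cases j <;> simp [F, map_star]

theorem comp_map_algebraMap {ι : Type*} [Fintype ι] [DecidableEq ι] (M : Matrix (Fin 2) (Fin 2) ℂ) :
    Matrix.compRingEquiv (Fin 2) ι ℂ (M.map (algebraMap ℂ (Matrix ι ι ℂ))) = M ⊗ₖ 1 := by
  ext ⟨i, a⟩ ⟨j, b⟩
  simp [Matrix.algebraMap_matrix_apply, Matrix.one_apply]

theorem comp_qppAlg {ι : Type*} [Fintype ι] [DecidableEq ι] (L : ℕ) (ω : ℝ)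
    (θ φ : Fin (L + 1) → ℝ) (V : Matrix ι ι ℂ) :
    Matrix.compRingEquiv (Fin 2) ι ℂ (qppAlg L ω θ φ V) = qpp L ω θ φ V := by
  rw [qppAlg, qpp, map_mul, comp_map_algebraMap, map_list_prod, List.map_ofFn]
  congr 3
  ext1 l
  rw [Function.comp_apply, map_mul, comp_map_algebraMap]
  congr 1
  split_ifs <;> ext ⟨i, a⟩ ⟨j, b⟩ <;> fin_cases i <;> fin_cases j <;>
    simp [ctrl, Matrix.star_eq_conjTranspose]

end Signal

/-- Adjacent scalars cancel in pairs. With `c = e^{ix/2}` they are the phases by which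
`diag(e^{-ix}, 1)` and `diag(1, e^{ix})` differ from `R_z(x)`; hence the even number of layers. -/
theorem prod_ofFn_alternating_smul {A : Type*} [Ring A] [Algebra ℂ A] {c : ℂ} (hc : c ≠ 0) (N : ℕ) :
    ∀ M : Fin (2 * N) → A,
      (List.ofFn fun l : Fin (2 * N) => (if Even (l : ℕ) then c⁻¹ else c) • M l).prod =
        (List.ofFn M).prod := by
  induction N with
  | zero => intro M; simp
  | succ N ih =>
    intro M
    have key : ∀ M : Fin (2 * N + 1 + 1) → A,
        (List.ofFn fun l => (if Even (l : ℕ) then c⁻¹ else c) • M l).prod =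
          (List.ofFn M).prod := by
      intro M
      rw [List.ofFn_succ, List.ofFn_succ, List.ofFn_succ, List.ofFn_succ]
      simp only [List.prod_cons, Fin.val_succ, Fin.val_zero, Nat.even_add_one, not_not, Even.zero,
        not_true_eq_false, if_true, if_false]
      rw [ih (fun l => M l.succ.succ)]
      simp only [smul_mul_assoc, mul_smul_comm, smul_smul, mul_inv_cancel₀ hc, one_smul]
    exact key M

theorem qppAlg_exp (N : ℕ) (ω : ℝ) (θ φ : Fin (2 * N + 1) → ℝ) (x : ℝ) :
    qppAlg (2 * N) ω θ φ (Complex.exp (Complex.I * x)) = qsp (2 * N) ω θ φ x := by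
  have hs : star (Complex.exp (Complex.I * x)) = Complex.exp (-(Complex.I * x)) := by
    rw [Complex.star_def, ← Complex.exp_conj]; simp
  have hid : ∀ M : Matrix (Fin 2) (Fin 2) ℂ, M.map (algebraMap ℂ ℂ) = M := fun M => by
    ext i j; simp
  rw [qppAlg, qsp, hid, ← prod_ofFn_alternating_smul
    (Complex.exp_ne_zero (Complex.I * x / 2)) N
    (fun l => rotZ x * rotY (θ l.succ) * rotZ (φ l.succ))]
  congr 3
  ext1 l
  rw [hid, Matrix.mul_assoc (rotZ x), ← Matrix.smul_mul]
  congr 1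
  rw [hs, rotZ, ← Complex.exp_neg]
  split_ifs <;> ext i j <;> fin_cases i <;> fin_cases j <;> simp [← Complex.exp_add] <;> ring_nf

theorem rotZ_mem_unitary (φ : ℝ) : rotZ φ ∈ Matrix.unitaryGroup (Fin 2) ℂ := by
  rw [Matrix.mem_unitaryGroup_iff]
  ext i j
  fin_cases i <;> fin_cases j <;>
    simp [rotZ, Matrix.mul_apply, Matrix.star_apply, ← Complex.exp_conj, ← Complex.exp_add,
      Complex.conj_ofNat, neg_div]

theorem rotY_mem_unitary (θ : ℝ) : rotY θ ∈ Matrix.unitaryGroup (Fin 2) ℂ := by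
  have h : (Real.cos (θ / 2) : ℂ) * Real.cos (θ / 2) + Real.sin (θ / 2) * Real.sin (θ / 2) = 1 := by
    have := Real.cos_sq_add_sin_sq (θ / 2)
    rw [sq, sq] at this
    exact_mod_cast this
  rw [Matrix.mem_unitaryGroup_iff]
  ext i j
  fin_cases i <;> fin_cases j <;>
    simp [rotY, Matrix.mul_apply, Matrix.star_apply, ← Complex.cos_conj, ← Complex.sin_conj,
      Complex.conj_ofNat] <;>
    push_cast at h <;>
    first
      | ring1
      | linear_combination h

theorem qsp_mem_unitary (L : ℕ) (ω : ℝ) (θ φ : Fin (L + 1) → ℝ) (x : ℝ) :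
    qsp L ω θ φ x ∈ Matrix.unitaryGroup (Fin 2) ℂ := by
  rw [qsp]
  refine mul_mem (mul_mem (mul_mem (rotZ_mem_unitary _) (rotY_mem_unitary _))
    (rotZ_mem_unitary _)) (Submonoid.list_prod_mem _ fun M hM => ?_)
  obtain ⟨l, rfl⟩ := List.mem_ofFn.mp hM
  exact mul_mem (mul_mem (rotZ_mem_unitary _) (rotY_mem_unitary _)) (rotZ_mem_unitary _)

theorem norm_qsp_column (L : ℕ) (ω : ℝ) (θ φ : Fin (L + 1) → ℝ) (x : ℝ) :
    ‖qsp L ω θ φ x 0 0‖ ^ 2 + ‖qsp L ω θ φ x 1 0‖ ^ 2 = 1 := by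
  have h := congrFun (congrFun (Matrix.mem_unitaryGroup_iff'.mp (qsp_mem_unitary L ω θ φ x)) 0) 0
  rw [Matrix.mul_apply, Fin.sum_univ_two, Matrix.star_apply, Matrix.star_apply, Complex.star_def,
    Complex.conj_mul', Complex.conj_mul', Matrix.one_apply_eq] at h
  exact_mod_cast h

/-- The squared distance of the unit vectors `(P, Q)` and `(F, 0)` is `2 Re(conj F (F - P))`. Thus
accuracy `δ²/2` in `P` controls the leakage `Q` as well. -/
theorem column_error_le {P Q F : ℂ} (hPQ : ‖P‖ ^ 2 + ‖Q‖ ^ 2 = 1) (hF : ‖F‖ = 1) :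
    ‖P - F‖ ^ 2 + ‖Q‖ ^ 2 ≤ 2 * ‖P - F‖ := by
  have h1 : ‖P - F‖ ^ 2 + ‖Q‖ ^ 2 = 2 * (starRingEnd ℂ F * (F - P)).re := by
    have hF2 : ‖F‖ ^ 2 = 1 := by rw [hF]; norm_num
    simp only [← Complex.normSq_eq_norm_sq, Complex.normSq_apply, Complex.mul_re, Complex.sub_re,
      Complex.sub_im, Complex.conj_re, Complex.conj_im] at *
    linarith
  have h2 := Complex.re_le_norm (starRingEnd ℂ F * (F - P))
  rw [norm_mul, Complex.norm_conj, hF, one_mul, norm_sub_rev] at h2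
  linarith

/-! ### From the unit circle to operators -/

section Processing

variable {ι : Type*} [Fintype ι] [DecidableEq ι]

/-- The isometry `|0⟩ ⊗ I`. -/
def initQubit (ι : Type*) [DecidableEq ι] : Matrix (Fin 2 × ι) ι ℂ :=
  Matrix.of fun p j => if p.1 = 0 ∧ p.2 = j then 1 else 0

/-- The Gram matrix of the error is the image of the scalar squared column error under the
functional calculus of `V`. Star homomorphisms are contractive, so the pointwise bound `δ²` on the
spectrum passes to the operator. -/
theorem qpp_initQubit_sub_norm_le {N : ℕ} {ω : ℝ} {θ φ : Fin (2 * N + 1) → ℝ} {τ δ : ℝ}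
    (hδ : 0 ≤ δ)
    (h : ∀ x : ℝ, ‖qsp (2 * N) ω θ φ x 0 0 -
      Complex.exp (-(Complex.I * ((τ * Real.cos x : ℝ) : ℂ)))‖ ≤ δ ^ 2 / 2)
    {V : Matrix ι ι ℂ} (hV : V ∈ Matrix.unitaryGroup ι ℂ) :
    ‖qpp (2 * N) ω θ φ V * initQubit ι -
      initQubit ι * NormedSpace.exp ((-(Complex.I * τ / 2)) • (V + Vᴴ))‖ ≤ δ := by
  have hn : IsStarNormal V := ⟨by
    rw [Commute, SemiconjBy, Matrix.mem_unitaryGroup_iff.mp hV, Matrix.mem_unitaryGroup_iff'.mp hV]⟩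
  let Φ : C(spectrum ℂ V, ℂ) →⋆ₐ[ℂ] Matrix ι ι ℂ := cfcHom hn
  let v : C(spectrum ℂ V, ℂ) := (ContinuousMap.id ℂ).restrict (spectrum ℂ V)
  have hΦv : Φ v = V := cfcHom_id hn
  have hΦc : Continuous Φ := cfcHom_continuous hn
  let X : C(spectrum ℂ V, ℂ) := (-(Complex.I * τ / 2)) • (v + star v)
  have hΦX : Φ X = (-(Complex.I * τ / 2)) • (V + Vᴴ) := by
    simp only [X, map_smul, map_add, map_star, hΦv, Matrix.star_eq_conjTranspose]
  have hΦF : NormedSpace.exp ((-(Complex.I * τ / 2)) • (V + Vᴴ)) = Φ (NormedSpace.exp X) := by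
    rw [← hΦX, NormedSpace.map_exp Φ hΦc]
  set F := NormedSpace.exp X with hF
  set W := qppAlg (2 * N) ω θ φ v with hW
  have hq : qpp (2 * N) ω θ φ V = Matrix.compRingEquiv (Fin 2) ι ℂ (W.map Φ) := by
    rw [hW, qppAlg_map, hΦv, comp_qppAlg]
  set f : C(spectrum ℂ V, ℂ) := star (W 0 0 - F) * (W 0 0 - F) + star (W 1 0) * W 1 0 with hf
  -- pointwise estimate
  have hpt : ‖f‖ ≤ δ ^ 2 := by
    rw [ContinuousMap.norm_le _ (by positivity)]
    intro σ
    have hσ : ‖(σ : ℂ)‖ = 1 := by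
      simpa using spectrum.subset_circle_of_unitary hV σ.2
    obtain ⟨x, hx⟩ : ∃ x : ℝ, (σ : ℂ) = Complex.exp (Complex.I * x) :=
      ⟨Complex.arg σ, by
        have := Complex.norm_mul_exp_arg_mul_I (σ : ℂ)
        rw [hσ, Complex.ofReal_one, one_mul, mul_comm] at this
        exact this.symm⟩
    let ev := ContinuousMap.evalStarAlgHom ℂ ℂ σ
    have hWx : ∀ i j, W i j σ = qsp (2 * N) ω θ φ x i j := by
      intro i j
      have := qppAlg_map ev (2 * N) ω θ φ v
      rw [show ev v = Complex.exp (Complex.I * x) from hx, qppAlg_exp] at this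
      exact congrFun (congrFun this i) j
    have hFx : F σ = Complex.exp (-(Complex.I * ((τ * Real.cos x : ℝ) : ℂ))) := by
      have h1 : ev F = NormedSpace.exp (ev X) :=
        NormedSpace.map_exp ev (continuous_eval_const σ) X
      have h2 : ev X = -(Complex.I * ((τ * Real.cos x : ℝ) : ℂ)) := by
        change (-(Complex.I * τ / 2)) * ((σ : ℂ) + star (σ : ℂ)) = _
        have hs : star (Complex.exp (Complex.I * x)) = Complex.exp (-(Complex.I * x)) := by
          rw [Complex.star_def, ← Complex.exp_conj]; simp
        rw [hx, hs, Complex.ofReal_mul, Complex.ofReal_cos, Complex.cos]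
        ring_nf
      rw [show F σ = ev F from rfl, h1, h2, Complex.exp_eq_exp_ℂ]
    have hfx : f σ = ((‖W 0 0 σ - F σ‖ ^ 2 + ‖W 1 0 σ‖ ^ 2 : ℝ) : ℂ) := by
      rw [Complex.ofReal_add, Complex.ofReal_pow, Complex.ofReal_pow, ← Complex.conj_mul',
        ← Complex.conj_mul']
      rfl
    rw [hfx, Complex.norm_real, Real.norm_of_nonneg (by positivity), hWx, hWx, hFx]
    have hnF : ‖Complex.exp (-(Complex.I * ((τ * Real.cos x : ℝ) : ℂ)))‖ = 1 := by
      rw [← Complex.norm_exp_ofReal_mul_I (-(τ * Real.cos x))]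
      congr 2; push_cast; ring
    linarith [column_error_le (norm_qsp_column (2 * N) ω θ φ x) hnF, h x]
  -- the Gram matrix of the error
  set K := qpp (2 * N) ω θ φ V * initQubit ι -
      initQubit ι * NormedSpace.exp ((-(Complex.I * τ / 2)) • (V + Vᴴ)) with hK
  have hK0 : ∀ a b, K (0, a) b = Φ (W 0 0 - F) a b := by
    intro a b
    rw [hK, hΦF, hq, Matrix.sub_apply, map_sub, Matrix.sub_apply, Matrix.mul_apply, Matrix.mul_apply]
    simp [Fintype.sum_prod_type, Fin.sum_univ_two, initQubit]
  have hK1 : ∀ a b, K (1, a) b = Φ (W 1 0) a b := by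
    intro a b
    rw [hK, hΦF, hq, Matrix.sub_apply, Matrix.mul_apply, Matrix.mul_apply]
    simp [Fintype.sum_prod_type, Fin.sum_univ_two, initQubit]
  have hgram : Kᴴ * K = Φ f := by
    rw [hf, map_add, map_mul, map_mul, map_star, map_star]
    ext a b
    rw [Matrix.mul_apply, Fintype.sum_prod_type, Fin.sum_univ_two, Matrix.add_apply,
      Matrix.mul_apply, Matrix.mul_apply]
    simp only [Matrix.conjTranspose_apply, Matrix.star_apply, hK0, hK1]
  have hsq : ‖K‖ * ‖K‖ ≤ δ * δ := by
    rw [← Matrix.l2_opNorm_conjTranspose_mul_self, hgram, ← sq]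
    exact (NonUnitalStarAlgHom.norm_apply_le Φ f).trans hpt
  exact abs_le_of_sq_le_sq' (by nlinarith) hδ |>.2

/-- All powers intertwine, hence so do the exponential series. With the rectangular isometry as `E`,
this restricts the large exponential to `e^{-iHt}`. -/
theorem exp_mul_of_mul_eq {κ : Type*} [Fintype κ] [DecidableEq κ] {X : Matrix ι ι ℂ}
    {Y : Matrix κ κ ℂ} {E : Matrix ι κ ℂ} (h : X * E = E * Y) :
    NormedSpace.exp X * E = E * NormedSpace.exp Y := by
  have hp : ∀ k : ℕ, X ^ k * E = E * Y ^ k := by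
    intro k
    induction k with
    | zero => simp
    | succ k ih => rw [pow_succ, Matrix.mul_assoc, h, ← Matrix.mul_assoc, ih, Matrix.mul_assoc,
        ← pow_succ]
  have hX : HasSum (fun k : ℕ => ((k.factorial : ℂ)⁻¹ • X ^ k) * E) (NormedSpace.exp X * E) :=
    (NormedSpace.exp_series_hasSum_exp' (𝕂 := ℂ) X).map
      (Matrix.addMonoidHomMulRight E) (continuous_id.matrix_mul continuous_const)
  have hY : HasSum (fun k : ℕ => E * ((k.factorial : ℂ)⁻¹ • Y ^ k)) (E * NormedSpace.exp Y) :=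
    (NormedSpace.exp_series_hasSum_exp' (𝕂 := ℂ) Y).map
      (Matrix.addMonoidHomMulLeft E) (continuous_const.matrix_mul continuous_id)
  refine hX.unique ?_
  convert hY using 2 with k
  rw [Matrix.smul_mul, Matrix.mul_smul, hp]

end Processing

theorem initAncilla_eq (m n : ℕ) :
    initAncilla m n = initQubit (Fin 2 × BlockReg m n) * initBlock m n := by
  ext p j
  rw [mul_initBlock_apply, initAncilla, initQubit, Matrix.of_apply, Matrix.of_apply]
  simp [Prod.ext_iff]

theorem norm_initBlock_le (m n : ℕ) : ‖initBlock m n‖ ≤ 1 := by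
  have h := Matrix.l2_opNorm_conjTranspose_mul_self (initBlock m n)
  rw [conjTranspose_initBlock_mul, CStarRing.norm_one] at h
  nlinarith [norm_nonneg (initBlock m n)]

theorem qpp_simulates {N : ℕ} {ω : ℝ} {θ φ : Fin (2 * N + 1) → ℝ} {Λ t δ : ℝ} (hΛ : 0 < Λ)
    (hδ : 0 ≤ δ)
    (h : ∀ x : ℝ, ‖qsp (2 * N) ω θ φ x 0 0 -
      Complex.exp (-(Complex.I * ((Λ * t * Real.cos x : ℝ) : ℂ)))‖ ≤ δ ^ 2 / 2)
    {m n : ℕ} {H : Matrix (Qubits n) (Qubits n) ℂ} {U : Matrix (BlockReg m n) (BlockReg m n) ℂ}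
    (hH : H.IsHermitian) (hU : IsBlockEncoding U (((Λ : ℂ)⁻¹) • H)) :
    Simulates (qpp (2 * N) ω θ φ (qubitize U)) H t δ := by
  have hΛ' : (Λ : ℂ) ≠ 0 := by exact_mod_cast hΛ.ne'
  have hH' : (((Λ : ℂ)⁻¹) • H).IsHermitian := by
    rw [Matrix.IsHermitian, Matrix.conjTranspose_smul, hH.eq]
    simp
  have hinter : ((-(Complex.I * ((Λ * t : ℝ) : ℂ) / 2)) • (qubitize U + (qubitize U)ᴴ)) *
      initBlock m n = initBlock m n * ((-(Complex.I * t)) • H) := by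
    rw [Matrix.smul_mul, qubitize_add_conjTranspose_mul_initBlock hH' hU.2, ← Matrix.mul_smul,
      smul_smul, smul_smul]
    congr 2
    push_cast
    field_simp
  have hexp := exp_mul_of_mul_eq hinter
  have hmain := qpp_initQubit_sub_norm_le hδ h (qubitize_mem_unitary hU.1)
  rw [Simulates, initAncilla_eq, Matrix.mul_assoc _ (initBlock m n), ← hexp, ← Matrix.mul_assoc,
    ← Matrix.mul_assoc, ← Matrix.sub_mul]
  calc _ ≤ _ := Matrix.l2_opNorm_mul _ _
    _ ≤ δ * 1 := by
        gcongr
        exact norm_initBlock_le m n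
    _ = δ := mul_one δ

/-! ### Rescaling, choice of `N` and query count -/

open Polynomial in
/-- The truncated Jacobi–Anger series as a polynomial in `e^{ix}`, shifted by `e^{iNx}`. -/
theorem exists_jacobiAnger_polynomial (N : ℕ) (z : ℝ) : ∃ p : ℂ[X], p.natDegree ≤ 2 * N ∧
    ∀ x : ℝ, p.eval (Complex.exp (Complex.I * x)) =
      Complex.exp (Complex.I * x) ^ N * jacobiAnger N z x := by
  refine ⟨∑ k ∈ Finset.Icc (-(N : ℤ)) (N : ℤ),
    C (Complex.I ^ k * (besselJ k z : ℂ)) * X ^ (k + N).toNat, ?_, fun x => ?_⟩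
  · refine natDegree_sum_le_of_forall_le _ _ fun k hk => ?_
    rw [Finset.mem_Icc] at hk
    exact (natDegree_C_mul_X_pow_le _ _).trans (by omega)
  · rw [eval_finsetSum, jacobiAnger, Finset.mul_sum]
    refine Finset.sum_congr rfl fun k hk => ?_
    rw [Finset.mem_Icc] at hk
    obtain ⟨j, hj⟩ : ∃ j : ℕ, k + N = j := ⟨(k + N).toNat, by omega⟩
    have hk' : (k : ℂ) = j - N := by
      have : k = j - N := by omega
      rw [this]; push_cast; ring
    rw [hj, Int.toNat_natCast, eval_mul, eval_C, eval_pow, eval_X, hk', ← Complex.exp_nat_mul,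
      ← Complex.exp_nat_mul, mul_left_comm (Complex.exp _), ← Complex.exp_add]
    congr 2
    ring

/-- Angles for the rescaled truncated Jacobi–Anger series. -/
theorem exists_angles_jacobiAnger {N : ℕ} {z ε : ℝ} (hε : 0 < ε)
    (h : ∀ x : ℝ, ‖jacobiAnger N z x - Complex.exp (Complex.I * z * Real.cos x)‖ ≤ ε / 3) :
    ∃ (ω : ℝ) (θ φ : Fin (2 * N + 1) → ℝ) (s : ℝ), 0 < s ∧ s ≤ 1 ∧
      (∀ x : ℝ, qsp (2 * N) ω θ φ x 0 0 = (s : ℂ) * jacobiAnger N z x) ∧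
      ∀ x : ℝ, ‖qsp (2 * N) ω θ φ x 0 0 - Complex.exp (Complex.I * z * Real.cos x)‖ ≤ ε := by
  have hF : ∀ x : ℝ, ‖Complex.exp (Complex.I * z * Real.cos x)‖ = 1 := fun x => by
    rw [← Complex.norm_exp_ofReal_mul_I (z * Real.cos x)]
    congr 2; push_cast; ring
  obtain ⟨p, hp, hpe⟩ := exists_jacobiAnger_polynomial N z
  -- The series has modulus at most `1 + ε/3 < 1/s`, giving the strict inequality Fejér–Riesz needs.
  -- The error is at most `sε/3 + (1 - s) = sε`.
  set s : ℝ := 1 / (1 + 2 * ε / 3) with hs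
  have hD : 0 < 1 + 2 * ε / 3 := by positivity
  have hs0 : 0 < s := by positivity
  have hsD : s * (1 + 2 * ε / 3) = 1 := by rw [hs]; field_simp
  have hs1 : s ≤ 1 := by nlinarith
  have hnorm : ∀ x : ℝ, ‖(s : ℂ) * jacobiAnger N z x‖ < 1 := fun x => by
    rw [norm_mul, Complex.norm_real, Real.norm_of_nonneg hs0.le]
    have : ‖jacobiAnger N z x‖ ≤ ε / 3 + 1 := by
      calc _ = ‖(jacobiAnger N z x - Complex.exp (Complex.I * z * Real.cos x)) +
            Complex.exp (Complex.I * z * Real.cos x)‖ := by rw [sub_add_cancel]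
        _ ≤ _ := norm_add_le _ _
        _ ≤ _ := by rw [hF]; gcongr; exact h x
    nlinarith
  have hcircle : ∀ w : ℂ, ‖w‖ = 1 → ∃ x : ℝ, w = Complex.exp (Complex.I * x) := fun w hw =>
    ⟨w.arg, by simpa [hw] using (norm_mul_exp_arg w).symm⟩
  have hpd : (Polynomial.C (s : ℂ) * p).natDegree ≤ 2 * N :=
    (Polynomial.natDegree_C_mul_le _ _).trans hp
  obtain ⟨q, hq, hpq⟩ := exists_complement hpd (fun w hw => by
    obtain ⟨x, rfl⟩ := hcircle w hw
    rw [Polynomial.eval_mul, Polynomial.eval_C, hpe, mul_left_comm, norm_mul, norm_pow, hw, one_pow,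
      one_mul]
    exact hnorm x)
  obtain ⟨ω, θ, φ, hang⟩ := exists_qsp_angles (2 * N) _ q hpd hq hpq
  have hP : ∀ x : ℝ, qsp (2 * N) ω θ φ x 0 0 = (s : ℂ) * jacobiAnger N z x := fun x => by
    have he : Complex.exp (-(Complex.I * x / 2)) ^ (2 * N) * Complex.exp (Complex.I * x) ^ N = 1 := by
      rw [pow_mul, ← mul_pow, sq, ← Complex.exp_add, ← Complex.exp_add]
      ring_nf
      simp
    rw [(hang x).1, Polynomial.eval_mul, Polynomial.eval_C, hpe]
    linear_combination (s * jacobiAnger N z x) * he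
  refine ⟨ω, θ, φ, s, hs0, hs1, hP, fun x => ?_⟩
  rw [hP]
  calc ‖(s : ℂ) * jacobiAnger N z x - Complex.exp (Complex.I * z * Real.cos x)‖
      = ‖(s : ℂ) * (jacobiAnger N z x - Complex.exp (Complex.I * z * Real.cos x)) +
          ((s - 1 : ℝ) : ℂ) * Complex.exp (Complex.I * z * Real.cos x)‖ := by
        congr 1; push_cast; ring
    _ ≤ s * (ε / 3) + (1 - s) := by
        refine (norm_add_le _ _).trans (add_le_add ?_ ?_)
        · rw [norm_mul, Complex.norm_real, Real.norm_of_nonneg hs0.le]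
          gcongr
          exact h x
        · rw [norm_mul, hF, mul_one, Complex.norm_real, Real.norm_of_nonpos (by linarith)]
          linarith
    _ ≤ ε := by nlinarith

theorem simRate_nonneg {z δ : ℝ} (hz : 0 ≤ z) (hδ : 0 < δ) (hδ2 : δ ^ 2 ≤ 2) :
    0 ≤ simRate z δ := by
  rw [simRate]
  split_ifs with h
  · exact le_rfl
  · have hL : 0 ≤ Real.log (2 / δ ^ 2) :=
      Real.log_nonneg (by rw [le_div_iff₀ (by positivity)]; linarith)
    have hu : 0 ≤ Real.log (2 / δ ^ 2) / z := by positivity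
    have := (half_exp_half_log_le hu).1
    positivity

theorem theorem9 :
    ∃ c C : ℝ, 0 < c ∧ 0 < C ∧
      ∀ Λ t δ : ℝ, 0 < Λ → 0 < δ → δ ≤ Real.sqrt 2 →
        ∃ (N : ℕ) (ω : ℝ) (θ φ : Fin (2 * N + 1) → ℝ),
          -- the number of queries
          ((simCircuit (2 * N) ω θ φ).queryCount : ℝ) ≤ C * simRate (Λ * |t|) δ ∧
          (1 ≤ simRate (Λ * |t|) δ →
            c * simRate (Λ * |t|) δ ≤ ((simCircuit (2 * N) ω θ φ).queryCount : ℝ)) ∧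
          -- the processed function is a rescaled truncated Jacobi–Anger series
          (∃ s : ℝ, 0 < s ∧ s ≤ 1 ∧
            ∀ x : ℝ, qsp (2 * N) ω θ φ x 0 0 = (s : ℂ) * jacobiAnger N (-(Λ * t)) x) ∧
          (∀ x : ℝ, ‖qsp (2 * N) ω θ φ x 0 0 -
            Complex.exp (-(Complex.I * ((Λ * t * Real.cos x : ℝ) : ℂ)))‖ ≤ δ ^ 2 / 2) ∧
          -- the circuit is phase processing of the qubitized encoding and simulates `e^{-iHt}`
          ∀ (n m : ℕ) (H : Matrix (Qubits n) (Qubits n) ℂ)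
            (U : Matrix (BlockReg m n) (BlockReg m n) ℂ),
            H.IsHermitian → ‖H‖ ≤ Λ → IsBlockEncoding U (((Λ : ℂ)⁻¹) • H) →
              (simCircuit (2 * N) ω θ φ).eval U = qpp (2 * N) ω θ φ (qubitize U) ∧
              Simulates ((simCircuit (2 * N) ω θ φ).eval U) H t δ := by
  -- The count is `4N` with `N = ⌊2e³R⌋`. For `R ≥ 1`, `N > 2e³R - 1 ≥ R`, whence the lower constant
  -- `4`.
  refine ⟨4, 8 * Real.exp 3, by norm_num, by positivity, fun Λ t δ hΛ hδ hδ' => ?_⟩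
  have hδ2 : δ ^ 2 ≤ 2 := by
    have := Real.sq_sqrt (show (0 : ℝ) ≤ 2 by norm_num)
    nlinarith
  have habs : |(-(Λ * t))| = Λ * |t| := by rw [abs_neg, abs_mul, abs_of_pos hΛ]
  have hz : 0 ≤ Λ * |t| := by positivity
  have hR := simRate_nonneg hz hδ hδ2
  have he3 : 1 ≤ Real.exp 3 := Real.one_le_exp (by norm_num)
  set R := simRate (Λ * |t|) δ with hRdef
  -- Rounding down keeps the upper bound free of an additive constant, even at `R = 0`; the tail
  -- estimate only needs `N + 1` to exceed `2e³R`.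
  set N := ⌊2 * Real.exp 3 * R⌋₊ with hN
  have hN1 : (N : ℝ) ≤ 2 * Real.exp 3 * R := Nat.floor_le (by positivity)
  have hN2 : 2 * Real.exp 3 * R < N + 1 := Nat.lt_floor_add_one _
  obtain ⟨hzM, htail⟩ := tail_le_of_simRate_le (k := N + 1) hz hδ hδ2 (Nat.cast_succ N)
    (by linarith [Nat.cast_nonneg (α := ℝ) N]) hN2.le
  obtain ⟨ω, θ, φ, s, hs0, hs1, hP, herr⟩ := exists_angles_jacobiAnger (N := N) (z := -(Λ * t))
    (ε := δ ^ 2 / 2) (by positivity) (fun x => by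
      refine (jacobiAnger_tail_bound N _ x (by rw [habs]; exact hzM)).trans ?_
      rw [habs]; exact htail)
  have herr' : ∀ x : ℝ, ‖qsp (2 * N) ω θ φ x 0 0 -
      Complex.exp (-(Complex.I * ((Λ * t * Real.cos x : ℝ) : ℂ)))‖ ≤ δ ^ 2 / 2 := fun x => by
    convert herr x using 4
    push_cast; ring
  have hcount : ((simCircuit (2 * N) ω θ φ).queryCount : ℝ) = 4 * N := by
    rw [simCircuit_queryCount]; push_cast; ring
  refine ⟨N, ω, θ, φ, ?_, fun h1 => ?_, ⟨s, hs0, hs1, hP⟩, herr', fun n m H U hH _ hU => ?_⟩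
  · rw [hcount]; linarith
  · rw [hcount]; nlinarith
  · have heval := simCircuit_eval (2 * N) ω θ φ hU.1
    exact ⟨heval, heval ▸ qpp_simulates hΛ hδ.le herr' hH hU⟩
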